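/- Let $\mathbf{O}$ be the Cayley octonions, with basis $e_0=1,e_1,\dots,e_7$, where $e_i^2=-e_0$ and $e_ie_j=-e_je_i$ for distinct $i,j\ge 1$, $e_2e_6=e_3e_4=e_5e_7=e_1$, together with all relations obtained by cyclically permuting the indices $1,\dots,7$. Let $\mathcal J=\{M\in M_3(\mathbf{O}) : M^*=M\}$ with the Jordan product $M\star N=\frac12(MN+NM)$, and let $$\det\begin{pmatrix}\xi_1&x_3&\overline{x}_2\\ \overline{x}_3&\xi_2&x_1\\ x_2&\overline{x}_1&\xi_3\end{pmatrix}=\xi_1\xi_2\xi_3-\sum_{i=1}^3\xi_i|x_i|^2+2\,\mathrm{Re}(x_1x_2x_3).$$ Let $E_{6(-26)}=\{g\in GL(\mathcal J) : \det\circ g=\det\}$ and $F_{4(-52)}=\{g\in E_{6(-26)} : g(I)=I\}$. An element of $\mathcal J$ is called positive if it can be moved by an element of $F_{4(-52)}$ to a diagonal matrix with positive diagonal entries. As a model of $E_{6(-26)}/F_{4(-52)}$ take $$X_{\mathbf O}=\{M\in\mathcal J : \det M=1,\ M \text{ positive}\},$$ on which $g\in E_{6(-26)}$ acts by letting $g\circ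 M$ be the element $N\in X_{\mathbf O}$ with $N\star N=g(M\star M)$. The distance on $X_{\mathbf O}$ is $d_{\mathbf O}(M,N)=\log\max_i d_i+\log\max_i d_i^{-1}$, where $M=g\circ I$ and $N=g\circ D$ with $g\in E_{6(-26)}$ and $D\in X_{\mathbf O}$ diagonal with entries $d_1,d_2,d_3>0$. Let $X_{\mathbf C}$ be the set of positive definite Hermitian matrices in $SL_3(\mathbf C)$, a model of $SL_3(\mathbf C)/SU_3(\mathbf C)$, with the action $g(z)=(gz^2g^*)^{1/2}$ of $SL_3(\mathbf C)$ and the distance $d_{\mathbf C}(x,y)=\log\|x^{-1}y\|+\log\|y^{-1}x\|$, where $\|\cdot\|$ is the operator norm on $\mathbf{C}^3$. Call the curves $t\mapsto g\circ e^{tH}$ (respectively $t\mapsto g(e^{tH})$), with $g\in E_{6(-26)}$ (respectively $g\in SL_3(\mathbf C)$) and $H$ a real diagonal matrix of trace $0$, the geodesic lines of $X_{\mathbf O}$ (respectively $X_{\mathbf C}$); they are the geodesics of the symmetric space, constant curves included. A map $\varphi:X_{\mathbf C}\to X_{\mathbf O}$ is called a totally geodesic embedding if 1. $d_{\mathbf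 O}(\varphi(x),\varphi(y))=d_{\mathbf C}(x,y)$ for all $x,y\in X_{\mathbf C}$; 2. $\varphi\circ\gamma$ is a geodesic line of $X_{\mathbf O}$ for every geodesic line $\gamma$ of $X_{\mathbf C}$; 3. the image of $\varphi$ contains every geodesic segment joining two of its points, that is, the image of every map $\gamma:[0,L]\to X_{\mathbf O}$ with $L\ge 0$, $\gamma(0),\gamma(L)\in\varphi(X_{\mathbf C})$ and $d_{\mathbf O}(\gamma(s),\gamma(t))=|s-t|$ for all $s,t\in[0,L]$. **Proposition.** For any three points $x,y,z\in X_{\mathbf O}$ there is a totally geodesic embedding $\varphi:X_{\mathbf C}\to X_{\mathbf O}$ whose image contains $x$, $y$ and $z$. -/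

import Mathlib

noncomputable section

namespace FreudenthalE6

open scoped ComplexOrder

/-- The Cayley octonions, as a real vector space of dimension 8. The first component is the
coefficient of `e₀ = 1`; the second one gives the coefficients of `e₁, …, e₇`, the indices
being read modulo 7 (so that `e₇` has index `0 : Fin 7`). -/
def Octonion : Type := ℝ × (Fin 7 → ℝ)

namespace Octonion

instance : AddCommGroup Octonion := inferInstanceAs (AddCommGroup (ℝ × (Fin 7 → ℝ)))

instance : Module ℝ Octonion := inferInstanceAs (Module ℝ (ℝ × (Fin 7 → ℝ)))

/-- The real part. -/
def re (x : Octonion) : ℝ := x.1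

/-- The imaginary coefficients. -/
def im (x : Octonion) : Fin 7 → ℝ := x.2

/-- A real number, as a multiple of `e₀`. -/
def ofReal (r : ℝ) : Octonion := (r, 0)

/-- The octonion product: the bilinear product with unit `e₀` for which `eᵢ² = -e₀`,
`eᵢ eⱼ = - eⱼ eᵢ` for distinct `i, j ≥ 1`, and
`eₖ₊₁ eₖ₊₅ = eₖ₊₂ eₖ₊₃ = eₖ₊₄ eₖ₊₆ = eₖ` with indices modulo 7
(for `k = 1` this reads `e₂ e₆ = e₃ e₄ = e₅ e₇ = e₁`). -/
instance : Mul Octonion where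
  mul x y :=
    (x.re * y.re - ∑ i, x.im i * y.im i,
      fun k => x.re * y.im k + x.im k * y.re
        + (x.im (k + 1) * y.im (k + 5) - x.im (k + 5) * y.im (k + 1))
        + (x.im (k + 2) * y.im (k + 3) - x.im (k + 3) * y.im (k + 2))
        + (x.im (k + 4) * y.im (k + 6) - x.im (k + 6) * y.im (k + 4)))

/-- The conjugation `x ↦ x̄`. -/
instance : Star Octonion where
  star x := (x.re, -x.im)

/-- The squared norm `|x|² = x x̄`. -/
def normSq (x : Octonion) : ℝ := x.re ^ 2 + ∑ i, x.im i ^ 2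

theorem ext_re_im {x y : Octonion} (h : x.re = y.re) (h' : ∀ i, x.im i = y.im i) : x = y :=
  Prod.ext h (funext h')

theorem star_add' (x y : Octonion) : star (x + y) = star x + star y :=
  Prod.ext rfl (neg_add x.im y.im)

theorem star_zero' : star (0 : Octonion) = 0 := Prod.ext rfl neg_zero

theorem star_smul' (r : ℝ) (x : Octonion) : star (r • x) = r • star x :=
  Prod.ext rfl (smul_neg r x.im).symm

theorem star_ofReal (r : ℝ) : star (ofReal r) = ofReal r := Prod.ext rfl neg_zero

theorem star_mul' (x y : Octonion) : star (x * y) = star y * star x := by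
  apply ext_re_im
  · change x.re * y.re - ∑ i, x.im i * y.im i = y.re * x.re - ∑ i, (-y.im i) * (-x.im i)
    simp only [neg_mul_neg, mul_comm]
  · intro k
    change -(x.re * y.im k + x.im k * y.re
        + (x.im (k + 1) * y.im (k + 5) - x.im (k + 5) * y.im (k + 1))
        + (x.im (k + 2) * y.im (k + 3) - x.im (k + 3) * y.im (k + 2))
        + (x.im (k + 4) * y.im (k + 6) - x.im (k + 6) * y.im (k + 4)))
      = y.re * -x.im k + -y.im k * x.re
        + (-y.im (k + 1) * -x.im (k + 5) - -y.im (k + 5) * -x.im (k + 1))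
        + (-y.im (k + 2) * -x.im (k + 3) - -y.im (k + 3) * -x.im (k + 2))
        + (-y.im (k + 4) * -x.im (k + 6) - -y.im (k + 6) * -x.im (k + 4))
    ring

theorem star_sum' {ι : Type*} (s : Finset ι) (f : ι → Octonion) :
    star (∑ i ∈ s, f i) = ∑ i ∈ s, star (f i) :=
  map_sum (⟨⟨star, star_zero'⟩, star_add'⟩ : Octonion →+ Octonion) f s

end Octonion

/-! ### The exceptional Jordan algebra -/

/-- The exceptional Jordan algebra: the `3 × 3` octonionic matrices with `M* = M`. -/
def jordanSubmodule : Submodule ℝ (Matrix (Fin 3) (Fin 3) Octonion) where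
  carrier := {M | M.conjTranspose = M}
  add_mem' := by
    intro M N hM hN
    ext1 i j
    have h₁ := congrFun (congrFun hM i) j
    have h₂ := congrFun (congrFun hN i) j
    change star (M j i + N j i) = M i j + N i j
    change star (M j i) = M i j at h₁
    change star (N j i) = N i j at h₂
    rw [Octonion.star_add', h₁, h₂]
  zero_mem' := by
    ext1 i j
    exact Octonion.star_zero'
  smul_mem' := by
    intro r M hM
    ext1 i j
    have h₁ := congrFun (congrFun hM i) j
    change star (r • M j i) = r • M i j
    change star (M j i) = M i j at h₁
    rw [Octonion.star_smul', h₁]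

/-- The exceptional Jordan algebra, as a type. -/
abbrev J : Type := jordanSubmodule

/-- The Jordan multiplication `M ⋆ N = (MN + NM) / 2`. -/
def jmul (M N : J) : J :=
  ⟨(1 / 2 : ℝ) • (M.1 * N.1 + N.1 * M.1), by
    have hM : ∀ i j, star (M.1 j i) = M.1 i j := fun i j => congrFun (congrFun M.2 i) j
    have hN : ∀ i j, star (N.1 j i) = N.1 i j := fun i j => congrFun (congrFun N.2 i) j
    refine jordanSubmodule.smul_mem _ ?_
    ext1 i j
    change star ((M.1 * N.1) j i + (N.1 * M.1) j i) = (M.1 * N.1) i j + (N.1 * M.1) i j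
    simp only [Matrix.mul_apply, Octonion.star_add', Octonion.star_sum', Octonion.star_mul', hM, hN]
    exact add_comm _ _⟩

/-- The diagonal element of the Jordan algebra with real diagonal entries `d`. -/
def diag (d : Fin 3 → ℝ) : J :=
  ⟨Matrix.diagonal fun i => Octonion.ofReal (d i), by
    ext1 i j
    change star (Matrix.diagonal (fun i => Octonion.ofReal (d i)) j i) = _
    by_cases h : i = j
    · subst h
      simp only [Matrix.diagonal_apply_eq, Octonion.star_ofReal]
    · rw [Matrix.diagonal_apply_ne _ h, Matrix.diagonal_apply_ne _ (Ne.symm h),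
        Octonion.star_zero']⟩

/-- The identity matrix. -/
def one : J := diag fun _ => 1

/-- Freudenthal's determinant
`ξ₁ξ₂ξ₃ - (ξ₁|x₁|² + ξ₂|x₂|² + ξ₃|x₃|²) + 2 Re(x₁x₂x₃)` of the matrix with rows
`(ξ₁, x₃, x̄₂)`, `(x̄₃, ξ₂, x₁)`, `(x₂, x̄₁, ξ₃)`. -/
def det (M : J) : ℝ :=
  (M.1 0 0).re * (M.1 1 1).re * (M.1 2 2).re
    - ((M.1 0 0).re * (M.1 1 2).normSq + (M.1 1 1).re * (M.1 2 0).normSq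
      + (M.1 2 2).re * (M.1 0 1).normSq)
    + 2 * ((M.1 1 2 * M.1 2 0) * M.1 0 1).re

/-- The group `E₆₍₋₂₆₎` of the linear automorphisms of `J` that preserve the determinant. -/
def E6 : Subgroup (J ≃ₗ[ℝ] J) where
  carrier := {g | ∀ M, det (g M) = det M}
  one_mem' := fun _ => rfl
  mul_mem' := fun {_ h} hg hh M => (hg (h M)).trans (hh M)
  inv_mem' := fun {g} hg M => by
    have h := hg (g.symm M)
    rw [LinearEquiv.apply_symm_apply] at h
    exact h.symm

/-- The maximal compact subgroup `F₄₍₋₅₂₎`: the stabilizer of the identity matrix in `E6`. -/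
def F4 : Subgroup (J ≃ₗ[ℝ] J) where
  carrier := {g | g ∈ E6 ∧ g one = one}
  one_mem' := ⟨E6.one_mem, rfl⟩
  mul_mem' := fun {g _} hg hh => ⟨E6.mul_mem hg.1 hh.1, (congrArg g hh.2).trans hg.2⟩
  inv_mem' := fun {g} hg => ⟨E6.inv_mem hg.1, g.symm_apply_eq.mpr hg.2.symm⟩

/-- An element of `J` is positive if diagonalizing it by an element of `F4` yields positive
diagonal entries. -/
def IsPositive (M : J) : Prop :=
  ∃ k ∈ F4, ∃ d : Fin 3 → ℝ, (∀ i, 0 < d i) ∧ k M = diag d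

/-! ### The symmetric space `X_O = E₆₍₋₂₆₎ / F₄₍₋₅₂₎` -/

/-- The model of `X_O`: positive elements of `J` of determinant one. -/
def XO : Type := {M : J // det M = 1 ∧ IsPositive M}

/-- `N = g ∘ M` for the action `g ∘ M = √(g(M²))` of `E6` on `X_O`: `N` is the positive element
of determinant one with `N ⋆ N = g (M ⋆ M)`. -/
def IsActO (g : E6) (M : J) (N : XO) : Prop :=
  jmul N.1 N.1 = g.1 (jmul M M)

/-- The largest of three real numbers. -/
def max3 (d : Fin 3 → ℝ) : ℝ := max (max (d 0) (d 1)) (d 2)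

/-- The distance on `X_O`: `d(M, N) = log ‖D‖ + log ‖D⁻¹‖`, where `D` is a diagonal element of
`X_O` such that `M = g ∘ I` and `N = g ∘ D` for some `g` in `E6`, and `‖D‖` is the largest diagonal
entry. Such `D` exists and is unique up to a permutation of its diagonal entries, so that the
set below has exactly one element. -/
def distO (M N : XO) : ℝ :=
  sInf {r | ∃ (g : E6) (d : Fin 3 → ℝ), (∀ i, 0 < d i) ∧ ∏ i, d i = 1 ∧
    IsActO g one M ∧ IsActO g (diag d) N ∧
    r = Real.log (max3 d) + Real.log (max3 fun i => (d i)⁻¹)}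

/-- The (affinely parametrized, complete) geodesics of the symmetric space `X_O`: the
curves `t ↦ g ∘ exp (t H)` with `g` in `E6` and `H` real diagonal of trace zero. -/
def IsGeodesicLineO (γ : ℝ → XO) : Prop :=
  ∃ (g : E6) (a : Fin 3 → ℝ), ∑ i, a i = 0 ∧
    ∀ t, IsActO g (diag fun i => Real.exp (t * a i)) (γ t)

/-- `γ`, restricted to `[0, L]`, is a geodesic from `M` to `N` for the distance of `X_O`. -/
def IsGeodesicSegmentO (γ : ℝ → XO) (L : ℝ) (M N : XO) : Prop :=
  0 ≤ L ∧ γ 0 = M ∧ γ L = N ∧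
    ∀ s ∈ Set.Icc 0 L, ∀ t ∈ Set.Icc 0 L, distO (γ s) (γ t) = |s - t|

/-! ### The symmetric space `X_C = SL₃(C) / SU₃` -/

/-- The model of `X_C`: positive definite Hermitian matrices of determinant one. -/
def XC : Type := {M : Matrix (Fin 3) (Fin 3) ℂ // M.PosDef ∧ M.det = 1}

/-- `N = g(M)` for the action `g(M) = (g M² g*)^{1/2}` of `SL₃(C)` on `X_C`. -/
def IsActC (g : Matrix.SpecialLinearGroup (Fin 3) ℂ) (M : Matrix (Fin 3) (Fin 3) ℂ) (N : XC) :
    Prop :=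
  N.1 * N.1 = g.1 * (M * M) * g.1.conjTranspose

/-- The operator norm of a complex `3 × 3` matrix acting on the Hermitian space `ℂ³`. -/
def opNorm (M : Matrix (Fin 3) (Fin 3) ℂ) : ℝ := ‖Matrix.toEuclideanCLM (n := Fin 3) (𝕜 := ℂ) M‖

/-- The distance `d(x, y) = log ‖x⁻¹ y‖ + log ‖y⁻¹ x‖` on `X_C`. -/
def distC (x y : XC) : ℝ :=
  Real.log (opNorm (x.1⁻¹ * y.1)) + Real.log (opNorm (y.1⁻¹ * x.1))

/-- The (affinely parametrized, complete) geodesics of the symmetric space `X_C`. -/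
def IsGeodesicLineC (γ : ℝ → XC) : Prop :=
  ∃ (g : Matrix.SpecialLinearGroup (Fin 3) ℂ) (a : Fin 3 → ℝ), ∑ i, a i = 0 ∧
    ∀ t, IsActC g (Matrix.diagonal fun i => (Real.exp (t * a i) : ℂ)) (γ t)

/-! ### Totally geodesic embeddings -/

/-- Totally geodesic embeddings of `X_C` in `X_O`: isometric maps which send the geodesics of the
symmetric space `X_C` to geodesics of the symmetric space `X_O`, and whose image contains
every geodesic segment (for the distance of `X_O`) joining two of its points. -/
structure IsTotallyGeodesicEmbedding (φ : XC → XO) : Prop where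
  isometric : ∀ x y, distO (φ x) (φ y) = distC x y
  map_geodesicLine : ∀ γ : ℝ → XC, IsGeodesicLineC γ → IsGeodesicLineO (φ ∘ γ)
  geodesicSegment_subset : ∀ x y (γ : ℝ → XO) (L : ℝ), IsGeodesicSegmentO γ L (φ x) (φ y) →
    ∀ t ∈ Set.Icc 0 L, γ t ∈ Set.range φ

end FreudenthalE6

end

noncomputable section

namespace FreudenthalE6

/-!
Write `M²` for `M ⋆ M`. The map `M ↦ M²` identifies `X_O` with the orbit of `I` under `E₆₍₋₂₆₎`,
on which the group acts linearly. A subfield `ℂ ⊆ 𝐎` turns the complex Hermitian matrices into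
elements of `J`, on which `SL₃(ℂ)` acts through `E₆₍₋₂₆₎`, because transvections do; hence every
`g₀` in `E₆₍₋₂₆₎` gives a map `A ↦ √(g₀(A²))` from `X_C` to `X_O`.

Three points of `X_O` can be moved so that the first one becomes `I` and the second one diagonal.
The stabilizer of the diagonal matrices, which acts on the off-diagonal entries through triality,
then moves the square of the third one to a matrix with entries in such a subfield, so that some
`g₀` works for the three points.

A point `M` on a segment from `I` to a diagonal `D` realizes the equality in the triangle
inequality. The bounds that prove this inequality compare the diagonal entries of `M²`, `D²` and
`I`, and elements of `J` with nonnegative eigenvalues and a zero diagonal entry have zeros in the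
same row. Equality thus makes `M` diagonal, which keeps the segment in the image.
-/

namespace Octonion

attribute [ext] ext_re_im

@[simp] theorem re_add (x y : Octonion) : (x + y).re = x.re + y.re := rfl
@[simp] theorem im_add (x y : Octonion) (k : Fin 7) : (x + y).im k = x.im k + y.im k := rfl
@[simp] theorem re_sub (x y : Octonion) : (x - y).re = x.re - y.re := rfl
@[simp] theorem re_neg (x : Octonion) : (-x).re = -x.re := rfl
@[simp] theorem im_neg (x : Octonion) (k : Fin 7) : (-x).im k = -x.im k := rfl
@[simp] theorem re_zero : (0 : Octonion).re = 0 := rfl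
@[simp] theorem im_zero (k : Fin 7) : (0 : Octonion).im k = 0 := rfl
@[simp] theorem re_smul (r : ℝ) (x : Octonion) : (r • x).re = r * x.re := rfl
@[simp] theorem im_smul (r : ℝ) (x : Octonion) (k : Fin 7) : (r • x).im k = r * x.im k := rfl
@[simp] theorem re_star (x : Octonion) : (star x).re = x.re := rfl
@[simp] theorem im_star (x : Octonion) (k : Fin 7) : (star x).im k = -x.im k := rfl
@[simp] theorem re_ofReal (r : ℝ) : (ofReal r).re = r := rfl
@[simp] theorem im_ofReal (r : ℝ) (k : Fin 7) : (ofReal r).im k = 0 := rfl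

theorem re_mul (x y : Octonion) : (x * y).re = x.re * y.re - ∑ i, x.im i * y.im i := rfl

theorem im_mul (x y : Octonion) (k : Fin 7) : (x * y).im k =
    x.re * y.im k + x.im k * y.re
        + (x.im (k + 1) * y.im (k + 5) - x.im (k + 5) * y.im (k + 1))
        + (x.im (k + 2) * y.im (k + 3) - x.im (k + 3) * y.im (k + 2))
        + (x.im (k + 4) * y.im (k + 6) - x.im (k + 6) * y.im (k + 4)) := rfl

instance : Module.Finite ℝ Octonion := inferInstanceAs (Module.Finite ℝ (ℝ × (Fin 7 → ℝ)))

instance : NonUnitalNonAssocRing Octonion where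
  left_distrib x y z := by
    ext k
    · simp only [re_mul, re_add, im_add, mul_add, Finset.sum_add_distrib]; ring
    · simp only [im_mul, re_add, im_add]; ring
  right_distrib x y z := by
    ext k
    · simp only [re_mul, re_add, im_add, add_mul, Finset.sum_add_distrib]; ring
    · simp only [im_mul, re_add, im_add]; ring
  zero_mul x := by ext k <;> simp [re_mul, im_mul]
  mul_zero x := by ext k <;> simp [re_mul, im_mul]

instance : IsScalarTower ℝ Octonion Octonion where
  smul_assoc r x y := by
    ext k
    · simp only [smul_eq_mul, re_mul, re_smul, im_smul, mul_sub, Finset.mul_sum, mul_assoc]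
    · simp only [smul_eq_mul, im_mul, re_smul, im_smul]; ring

instance : SMulCommClass ℝ Octonion Octonion where
  smul_comm r x y := by
    ext k
    · simp only [smul_eq_mul, re_mul, re_smul, im_smul, mul_sub, Finset.mul_sum, mul_left_comm]
    · simp only [smul_eq_mul, im_mul, re_smul, im_smul]; ring

instance : StarRing Octonion where
  star_involutive x := by ext k <;> simp
  star_mul := star_mul'
  star_add := star_add'

instance : StarModule ℝ Octonion where
  star_smul := star_smul'

/-! #### The multiplicative norm and the trace form -/

theorem re_mul_comm (x y : Octonion) : (x * y).re = (y * x).re := by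
  simp only [re_mul, mul_comm]

theorem re_mul_assoc (x y z : Octonion) : ((x * y) * z).re = (x * (y * z)).re := by
  simp only [re_mul, im_mul, Fin.sum_univ_seven, Fin.isValue, Fin.reduceAdd, zero_add]
  ring

theorem re_mul_rotate (x y z : Octonion) : (x * y * z).re = (y * z * x).re := by
  rw [re_mul_assoc, re_mul_comm]

theorem re_star_mul_star_mul_star (x y z : Octonion) :
    (star x * star y * star z).re = (z * y * x).re := by
  rw [re_mul_assoc z, ← re_star (z * _), star_mul, star_mul]

theorem star_mul_mul_cancel (x y : Octonion) : star x * (x * y) = x.normSq • y := by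
  ext k
  · simp only [re_mul, im_mul, re_star, im_star, re_smul, normSq, Fin.sum_univ_seven, Fin.isValue,
      Fin.reduceAdd, zero_add]
    ring
  · fin_cases k <;>
    simp only [re_mul, im_mul, re_star, im_star, im_smul, normSq, Fin.sum_univ_seven, Fin.isValue,
      Fin.reduceAdd, Fin.reduceFinMk, Fin.zero_eta, Fin.mk_one, zero_add] <;>
    ring

theorem moufang (u x y : Octonion) : (u * x) * (y * u) = u * ((x * y) * u) := by
  ext k
  · simp only [re_mul, im_mul, Fin.sum_univ_seven, Fin.isValue, Fin.reduceAdd, zero_add]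
    ring
  · fin_cases k <;>
    simp only [re_mul, im_mul, Fin.sum_univ_seven, Fin.isValue, Fin.reduceAdd, Fin.reduceFinMk,
      Fin.zero_eta, Fin.mk_one, zero_add] <;>
    ring

@[simp] theorem normSq_star (x : Octonion) : (star x).normSq = x.normSq := by simp [normSq]

@[simp] theorem normSq_neg (x : Octonion) : (-x).normSq = x.normSq := by simp [normSq]

@[simp] theorem normSq_zero : (0 : Octonion).normSq = 0 := by simp [normSq]

theorem mul_star_mul_cancel (x y : Octonion) : x * (star x * y) = x.normSq • y := by
  simpa using star_mul_mul_cancel (star x) y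

theorem mul_mul_star_cancel (y x : Octonion) : (y * x) * star x = x.normSq • y := by
  simpa using congrArg star (mul_star_mul_cancel x (star y))

theorem mul_star_mul_cancel_right (y x : Octonion) : (y * star x) * x = x.normSq • y := by
  simpa using mul_mul_star_cancel y (star x)

/-- The Euclidean inner product `Re (x̄ y)` of `𝐎 = ℝ⁸`, the polar form of `normSq`. -/
def innerForm : LinearMap.BilinForm ℝ Octonion :=
  LinearMap.mk₂ ℝ (fun x y => (star x * y).re) (by simp [add_mul])
    (by simp [smul_mul_assoc]) (by simp [mul_add]) (by simp [mul_smul_comm])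

theorem innerForm_apply (x y : Octonion) : innerForm x y = (star x * y).re := rfl

theorem innerForm_comm (x y : Octonion) : innerForm x y = innerForm y x := by
  simp only [innerForm_apply, ← re_star (star x * y), star_mul, star_star]

theorem innerForm_star_star (x y : Octonion) : innerForm (star x) (star y) = innerForm x y := by
  rw [innerForm_apply, innerForm_comm, innerForm_apply, star_star, re_mul_comm]

theorem innerForm_self (x : Octonion) : innerForm x x = x.normSq := by
  simp only [innerForm_apply, re_mul, normSq, re_star, im_star, neg_mul, Finset.sum_neg_distrib,
    sub_neg_eq_add, sq]

theorem innerForm_star_left (x y : Octonion) : innerForm (star x) y = (x * y).re := by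
  rw [innerForm_apply, star_star]

theorem innerForm_star_right (x y : Octonion) : innerForm x (star y) = (x * y).re := by
  rw [innerForm_comm, innerForm_star_left, re_mul_comm]

theorem normSq_add (x y : Octonion) :
    (x + y).normSq = x.normSq + 2 * innerForm x y + y.normSq := by
  simp only [← innerForm_self, map_add, LinearMap.add_apply, innerForm_comm y x]
  ring

theorem normSq_smul (r : ℝ) (x : Octonion) : (r • x).normSq = r ^ 2 * x.normSq := by
  simp only [← innerForm_self, map_smul, LinearMap.smul_apply, smul_eq_mul]
  ring

theorem normSq_mul (x y : Octonion) : (x * y).normSq = x.normSq * y.normSq := by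
  rw [← innerForm_self, innerForm_apply, star_mul, re_mul_assoc, star_mul_mul_cancel,
    mul_smul_comm, re_smul, ← innerForm_apply, innerForm_self]

theorem normSq_nonneg (x : Octonion) : 0 ≤ x.normSq := by
  unfold normSq; positivity

theorem normSq_eq_zero {x : Octonion} : x.normSq = 0 ↔ x = 0 := by
  refine ⟨fun h => ?_, by rintro rfl; exact normSq_zero⟩
  obtain ⟨hre, him⟩ := (add_eq_zero_iff_of_nonneg (sq_nonneg x.re)
    (Finset.sum_nonneg fun i _ => sq_nonneg (x.im i))).mp h
  rw [Finset.sum_eq_zero_iff_of_nonneg fun i _ => sq_nonneg _] at him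
  ext i
  · exact sq_eq_zero_iff.mp hre
  · exact sq_eq_zero_iff.mp (him i (Finset.mem_univ i))

theorem re_mul_mul_triality (u x y z : Octonion) :
    ((u * x) * (y * u) * ((star u * z) * star u)).re = u.normSq ^ 2 * (x * y * z).re :=
  calc ((u * x) * (y * u) * ((star u * z) * star u)).re
      = (star u * z * star u * u * (x * y * u)).re := by rw [moufang, ← re_mul_rotate]
    _ = u.normSq * (x * y * u * star u * z).re := by
        rw [mul_star_mul_cancel_right, smul_mul_assoc, re_smul, ← re_mul_rotate]
    _ = u.normSq ^ 2 * (x * y * z).re := by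
        rw [mul_mul_star_cancel, smul_mul_assoc, re_smul, ← mul_assoc, sq]

@[simp] theorem ofReal_mul (r : ℝ) (x : Octonion) : ofReal r * x = r • x := by
  ext k <;> simp [re_mul, im_mul]

@[simp] theorem mul_ofReal (x : Octonion) (r : ℝ) : x * ofReal r = r • x := by
  ext k <;> simp [re_mul, im_mul, mul_comm]

theorem ofReal_add (a b : ℝ) : ofReal (a + b) = ofReal a + ofReal b := by
  ext k <;> simp

theorem smul_ofReal (a b : ℝ) : a • ofReal b = ofReal (a * b) := by
  ext k <;> simp

theorem mul_star_self (x : Octonion) : x * star x = ofReal x.normSq := by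
  simpa only [mul_ofReal, one_smul, smul_ofReal, mul_one] using mul_star_mul_cancel x (ofReal 1)

theorem eq_ofReal_of_star_eq_self {x : Octonion} (h : star x = x) : x = ofReal x.re := by
  ext k
  · rfl
  · have := congrArg (im · k) h
    simp only [im_star] at this
    rw [im_ofReal]
    linarith

/-! #### Complex subfields -/

/-- The octonions `e` with `Re e = 0` and `|e| = 1`, i.e. the square roots of `-1`. -/
structure IsImaginaryUnit (e : Octonion) : Prop where
  re_eq_zero : e.re = 0
  normSq_eq_one : e.normSq = 1

/-- The embedding `ℂ → 𝐎` sending `i` to `e`, meant for an imaginary unit `e`. -/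
def ofComplex (e : Octonion) : ℂ →ₗ[ℝ] Octonion where
  toFun z := ofReal z.re + z.im • e
  map_add' z w := by simp only [Complex.add_re, Complex.add_im, ofReal_add, add_smul]; abel
  map_smul' r z := by simp [smul_add, smul_ofReal, mul_smul]

theorem ofComplex_apply (e : Octonion) (z : ℂ) : ofComplex e z = ofReal z.re + z.im • e := rfl

theorem ofComplex_ofReal (e : Octonion) (r : ℝ) : ofComplex e r = ofReal r := by
  simp [ofComplex_apply]

theorem IsImaginaryUnit.star_eq {e : Octonion} (he : e.IsImaginaryUnit) : star e = -e := by
  ext k <;> simp [he.re_eq_zero]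

theorem IsImaginaryUnit.mul_self {e : Octonion} (he : e.IsImaginaryUnit) :
    e * e = ofReal (-1) := by
  have h := mul_star_self (-e)
  rw [star_neg, he.star_eq, neg_neg, neg_mul, normSq_neg, he.normSq_eq_one] at h
  rw [← neg_neg (e * e), h]
  ext k <;> simp

theorem ofComplex_mul {e : Octonion} (he : e.IsImaginaryUnit) (z w : ℂ) :
    ofComplex e (z * w) = ofComplex e z * ofComplex e w := by
  simp only [ofComplex_apply, add_mul, mul_add, ofReal_mul, mul_ofReal, smul_mul_assoc,
    mul_smul_comm, he.mul_self, smul_ofReal, Complex.mul_re, Complex.mul_im]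
  ext k
  · simp only [re_add, re_smul, re_ofReal, he.re_eq_zero]; ring
  · simp only [im_add, im_smul, im_ofReal]; ring

theorem star_ofComplex {e : Octonion} (he : e.IsImaginaryUnit) (z : ℂ) :
    star (ofComplex e z) = ofComplex e (star z) := by
  simp [ofComplex_apply, star_ofReal, he.star_eq]

theorem re_ofComplex {e : Octonion} (he : e.IsImaginaryUnit) (z : ℂ) :
    (ofComplex e z).re = z.re := by
  simp [ofComplex_apply, he.re_eq_zero]

theorem innerForm_ofComplex {e : Octonion} (he : e.IsImaginaryUnit) (z w : ℂ) :
    innerForm (ofComplex e z) (ofComplex e w) = (star z * w).re := by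
  rw [innerForm_apply, star_ofComplex he, ← ofComplex_mul he, re_ofComplex he]

theorem normSq_ofComplex {e : Octonion} (he : e.IsImaginaryUnit) (z : ℂ) :
    (ofComplex e z).normSq = Complex.normSq z := by
  rw [← innerForm_self, innerForm_ofComplex he, Complex.star_def, mul_comm, Complex.mul_conj,
    Complex.ofReal_re]

theorem exists_isImaginaryUnit : ∃ e : Octonion, e.IsImaginaryUnit :=
  ⟨((0, Pi.single 0 1) : ℝ × (Fin 7 → ℝ)), rfl, by simp [normSq, re, im, Fin.sum_univ_seven]⟩

theorem exists_eq_ofComplex (x : Octonion) :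
    ∃ e : Octonion, e.IsImaginaryUnit ∧ ∃ z : ℂ, x = ofComplex e z := by
  obtain ⟨y, hx, hy⟩ : ∃ y : Octonion, x = ofReal x.re + y ∧ y.re = 0 :=
    ⟨x - ofReal x.re, by abel, by simp⟩
  rcases eq_or_ne y 0 with rfl | hy0
  · obtain ⟨e, he⟩ := exists_isImaginaryUnit
    exact ⟨e, he, x.re, by rw [ofComplex_ofReal, ← add_zero (ofReal x.re), ← hx]⟩
  · have hpos : 0 < y.normSq := y.normSq_nonneg.lt_of_ne' (normSq_eq_zero.not.mpr hy0)
    refine ⟨(√y.normSq)⁻¹ • y, ⟨by simp [hy], ?_⟩, ⟨x.re, √y.normSq⟩, ?_⟩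
    · rw [normSq_smul, inv_pow, Real.sq_sqrt hpos.le, inv_mul_cancel₀ hpos.ne']
    · rwa [ofComplex_apply, smul_inv_smul₀ (Real.sqrt_pos.mpr hpos).ne']

end Octonion

open Octonion

/-! ### Entries in the exceptional Jordan algebra -/

/-- The diagonal entries `ξ₁, ξ₂, ξ₃`. -/
def diagEntry (M : J) (i : Fin 3) : ℝ := (M.1 i i).re

/-- The off-diagonal entries `x₁, x₂, x₃`, each one being indexed by the row and column that do
not contain it. -/
def offEntry (M : J) (i : Fin 3) : Octonion := M.1 (i + 1) (i + 2)

theorem star_apply (M : J) (i j : Fin 3) : star (M.1 j i) = M.1 i j :=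
  congrFun (congrFun M.2 i) j

theorem coe_eq_of_entries (M : J) : M.1 =
    !![ofReal (diagEntry M 0), offEntry M 2, star (offEntry M 1);
      star (offEntry M 2), ofReal (diagEntry M 1), offEntry M 0;
      offEntry M 1, star (offEntry M 0), ofReal (diagEntry M 2)] := by
  ext1 i j
  fin_cases i <;> fin_cases j <;>
    first | exact eq_ofReal_of_star_eq_self (star_apply M _ _) | exact (star_apply M _ _).symm | rfl

theorem J_ext {M N : J} (hdiag : ∀ i, diagEntry M i = diagEntry N i)
    (hoff : ∀ i, offEntry M i = offEntry N i) : M = N := by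
  apply Subtype.ext
  rw [coe_eq_of_entries M, coe_eq_of_entries N]
  simp only [hdiag, hoff]

/-- The element of the Jordan algebra with given entries, see `coe_eq_of_entries`. -/
def ofEntries (d : Fin 3 → ℝ) (x : Fin 3 → Octonion) : J :=
  ⟨!![ofReal (d 0), x 2, star (x 1); star (x 2), ofReal (d 1), x 0;
    x 1, star (x 0), ofReal (d 2)], by
    change Matrix.conjTranspose _ = _
    ext1 i j
    fin_cases i <;> fin_cases j <;> first | exact star_ofReal _ | exact star_star _ | rfl⟩

@[simp] theorem diagEntry_ofEntries (d : Fin 3 → ℝ) (x : Fin 3 → Octonion) (i : Fin 3) :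
    diagEntry (ofEntries d x) i = d i := by
  fin_cases i <;> rfl

@[simp] theorem offEntry_ofEntries (d : Fin 3 → ℝ) (x : Fin 3 → Octonion) (i : Fin 3) :
    offEntry (ofEntries d x) i = x i := by
  fin_cases i <;> rfl

@[simp] theorem diagEntry_add (M N : J) (i : Fin 3) :
    diagEntry (M + N) i = diagEntry M i + diagEntry N i := rfl

@[simp] theorem offEntry_add (M N : J) (i : Fin 3) :
    offEntry (M + N) i = offEntry M i + offEntry N i := rfl

@[simp] theorem diagEntry_sub (M N : J) (i : Fin 3) :
    diagEntry (M - N) i = diagEntry M i - diagEntry N i := rfl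

@[simp] theorem offEntry_sub (M N : J) (i : Fin 3) :
    offEntry (M - N) i = offEntry M i - offEntry N i := rfl

@[simp] theorem diagEntry_smul (r : ℝ) (M : J) (i : Fin 3) :
    diagEntry (r • M) i = r * diagEntry M i := rfl

@[simp] theorem offEntry_smul (r : ℝ) (M : J) (i : Fin 3) :
    offEntry (r • M) i = r • offEntry M i := rfl

@[simp] theorem diagEntry_zero (i : Fin 3) : diagEntry 0 i = 0 := rfl

@[simp] theorem offEntry_zero (i : Fin 3) : offEntry 0 i = 0 := rfl

@[simp] theorem diagEntry_diag (d : Fin 3 → ℝ) (i : Fin 3) : diagEntry (diag d) i = d i := by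
  simp [diagEntry, diag]

@[simp] theorem offEntry_diag (d : Fin 3 → ℝ) (i : Fin 3) : offEntry (diag d) i = 0 :=
  Matrix.diagonal_apply_ne _ (by fin_cases i <;> decide)

@[simp] theorem diagEntry_one (i : Fin 3) : diagEntry one i = 1 := diagEntry_diag _ _

@[simp] theorem offEntry_one (i : Fin 3) : offEntry one i = 0 := offEntry_diag _ _

theorem det_eq (M : J) : det M = diagEntry M 0 * diagEntry M 1 * diagEntry M 2
    - (diagEntry M 0 * (offEntry M 0).normSq + diagEntry M 1 * (offEntry M 1).normSq
      + diagEntry M 2 * (offEntry M 2).normSq)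
    + 2 * (offEntry M 0 * offEntry M 1 * offEntry M 2).re := rfl

theorem diagEntry_jmul (M N : J) (i : Fin 3) :
    diagEntry (jmul M N) i = diagEntry M i * diagEntry N i
      + innerForm (offEntry M (i + 1)) (offEntry N (i + 1))
      + innerForm (offEntry M (i + 2)) (offEntry N (i + 2)) := by
  change ((1 / 2 : ℝ) • (M.1 * N.1 + N.1 * M.1) i i).re = _
  rw [re_smul, Matrix.add_apply, Matrix.mul_apply, Matrix.mul_apply, coe_eq_of_entries M,
    coe_eq_of_entries N]
  fin_cases i <;>
  · simp [Fin.sum_univ_three, ← innerForm_star_left, innerForm_star_star,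
      innerForm_comm (offEntry N _)]
    ring

theorem offEntry_jmul (M N : J) (i : Fin 3) : offEntry (jmul M N) i = (1 / 2 : ℝ) •
    ((diagEntry M (i + 1) + diagEntry M (i + 2)) • offEntry N i
      + (diagEntry N (i + 1) + diagEntry N (i + 2)) • offEntry M i
      + star (offEntry M (i + 1) * offEntry N (i + 2)
        + offEntry N (i + 1) * offEntry M (i + 2))) := by
  change (1 / 2 : ℝ) • (M.1 * N.1 + N.1 * M.1) (i + 1) (i + 2) = _
  rw [Matrix.add_apply, Matrix.mul_apply, Matrix.mul_apply, coe_eq_of_entries M,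
    coe_eq_of_entries N]
  congr 1
  fin_cases i <;>
  · simp [Fin.sum_univ_three, add_smul]
    abel

theorem jmul_comm (M N : J) : jmul M N = jmul N M := by
  simp only [jmul, add_comm]

theorem jmul_add (M N P : J) : jmul M (N + P) = jmul M N + jmul M P := by
  apply Subtype.ext
  change (1 / 2 : ℝ) • (M.1 * (N.1 + P.1) + (N.1 + P.1) * M.1) =
    (1 / 2 : ℝ) • (M.1 * N.1 + N.1 * M.1) + (1 / 2 : ℝ) • (M.1 * P.1 + P.1 * M.1)
  rw [mul_add, add_mul, ← smul_add]
  congr 1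
  abel

theorem add_jmul (M N P : J) : jmul (M + N) P = jmul M P + jmul N P := by
  rw [jmul_comm, jmul_add, jmul_comm P, jmul_comm P]

theorem jmul_eq_polarization (M N : J) :
    jmul M N = (1 / 2 : ℝ) • (jmul (M + N) (M + N) - jmul M M - jmul N N) := by
  rw [jmul_add, add_jmul, add_jmul, jmul_comm N M]
  module

theorem jmul_diag_diag (c d : Fin 3 → ℝ) : jmul (diag c) (diag d) = diag (c * d) :=
  J_ext (fun i => by simp [diagEntry_jmul]) fun i => by simp [offEntry_jmul]

theorem jmul_one_one : jmul one one = one :=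
  (jmul_diag_diag _ _).trans (congrArg diag (mul_one 1))

/-- The trace `ξ₁ + ξ₂ + ξ₃`. -/
def trace (M : J) : ℝ := ∑ i, diagEntry M i

/-- The coefficient of `t` in the characteristic polynomial `det (t - M)`. -/
def quad (M : J) : ℝ :=
  ∑ i, (diagEntry M (i + 1) * diagEntry M (i + 2) - (offEntry M i).normSq)

theorem det_smul_one_sub (t : ℝ) (M : J) :
    det (t • one - M) = t ^ 3 - trace M * t ^ 2 + quad M * t - det M := by
  have h : ∀ i, offEntry (t • one - M) i = (-1 : ℝ) • offEntry M i := fun i => by simp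
  simp only [det_eq, h, normSq_smul, smul_mul_assoc, mul_smul_comm, re_smul, diagEntry_sub,
    diagEntry_smul, diagEntry_one, trace, quad, Fin.sum_univ_three, Fin.isValue, Fin.reduceAdd,
    zero_add]
  ring

theorem trace_add (M N : J) : trace (M + N) = trace M + trace N := Finset.sum_add_distrib

theorem trace_jmul (M N : J) :
    trace (jmul M N) = trace M * trace N - (quad (M + N) - quad M - quad N) := by
  simp only [trace, quad, diagEntry_jmul, diagEntry_add, offEntry_add, normSq_add,
    Fin.sum_univ_three, Fin.isValue, Fin.reduceAdd, zero_add]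
  ring

theorem trace_jmul_jmul (M N : J) : trace (jmul (jmul M M) N) =
    (det (M + N) - det (M + (-1 : ℝ) • N)) / 2 - det N + trace M * trace (jmul M N)
      - quad M * trace N := by
  simp only [trace, quad, diagEntry_jmul, offEntry_jmul, det_eq, diagEntry_add, offEntry_add,
    diagEntry_smul, offEntry_smul, normSq_add, normSq_smul, add_mul, mul_add, smul_mul_assoc,
    mul_smul_comm, re_add, re_smul, map_add, map_smul, LinearMap.add_apply, LinearMap.smul_apply,
    star_add, innerForm_star_left, innerForm_self, smul_eq_mul, Fin.sum_univ_three, Fin.isValue,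
    Fin.reduceAdd, zero_add]
  rw [re_mul_rotate (offEntry N 0) (offEntry M 1) (offEntry M 2),
    ← re_mul_rotate (offEntry M 2) (offEntry M 0) (offEntry N 1)]
  ring

theorem trace_jmul_self (M : J) :
    trace (jmul M M) = ∑ i, (diagEntry M i ^ 2 + 2 * (offEntry M i).normSq) := by
  simp only [trace, diagEntry_jmul, innerForm_self, Fin.sum_univ_three, Fin.isValue,
    Fin.reduceAdd, zero_add]
  ring

theorem eq_zero_of_trace_jmul_self {M : J} (h : trace (jmul M M) = 0) : M = 0 := by
  have hnonneg : ∀ i, 0 ≤ 2 * (offEntry M i).normSq := fun i => by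
    have := (offEntry M i).normSq_nonneg
    positivity
  rw [trace_jmul_self, Finset.sum_eq_zero_iff_of_nonneg
    fun i _ => add_nonneg (sq_nonneg _) (hnonneg i)] at h
  have hi := fun i => (add_eq_zero_iff_of_nonneg (sq_nonneg _) (hnonneg i)).mp
    (h i (Finset.mem_univ i))
  refine J_ext (fun i => sq_eq_zero_iff.mp (hi i).1) fun i => ?_
  exact normSq_eq_zero.mp ((mul_eq_zero_iff_left two_ne_zero).mp (hi i).2)

theorem eq_of_trace_jmul_eq {M N : J} (h : ∀ P, trace (jmul M P) = trace (jmul N P)) :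
    M = N := by
  rw [← sub_eq_zero]
  apply eq_zero_of_trace_jmul_self
  have := h (M - N)
  rwa [← sub_add_cancel M N, add_jmul, trace_add, sub_add_cancel, add_eq_right] at this

theorem trace_quad_eq_of_det_smul_one_sub_eq {M N : J}
    (h : ∀ t : ℝ, det (t • one - M) = det (t • one - N)) : trace M = trace N ∧ quad M = quad N := by
  simp only [det_smul_one_sub] at h
  have h0 := h 0
  have h1 := h 1
  have h2 := h (-1)
  constructor <;> linarith

/-! ### The group `E₆₍₋₂₆₎` and the stabilizer of the unit -/

-- Translation by an element of the kernel changes neither the trace nor `quad`.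
theorem injective_of_det_map_eq {f : J →ₗ[ℝ] J} (hf : ∀ M, det (f M) = det M) :
    Function.Injective f := by
  rw [injective_iff_map_eq_zero]
  intro M hM
  have h (P : J) : trace (M + P) = trace P ∧ quad (M + P) = quad P :=
    trace_quad_eq_of_det_smul_one_sub_eq fun t => by
      rw [← hf, ← hf (t • one - P), map_sub, map_sub, map_add, hM, zero_add]
  have htrace : trace M = 0 := by simpa [trace_add] using (h M).1
  have hquad : quad M = 0 := by simpa [quad] using (h 0).2
  apply eq_zero_of_trace_jmul_self
  rw [trace_jmul, (h M).2, htrace, hquad]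
  ring

/-- The element of `E₆₍₋₂₆₎` given by a linear map that preserves the determinant. -/
def toE6 (f : J →ₗ[ℝ] J) (hf : ∀ M, det (f M) = det M) : E6 :=
  ⟨LinearEquiv.ofInjectiveEndo f (injective_of_det_map_eq hf), hf⟩

theorem det_E6_smul (g : E6) (M : J) : det (g • M) = det M := g.2 M

theorem isPositive_iff {M : J} :
    IsPositive M ↔ ∃ k : E6, k • one = one ∧ ∃ d : Fin 3 → ℝ, (∀ i, 0 < d i) ∧ k • M = diag d :=
  ⟨fun ⟨k, hk, d, hd, h⟩ => ⟨⟨k, hk.1⟩, hk.2, d, hd, h⟩,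
    fun ⟨k, hk, d, hd, h⟩ => ⟨k, ⟨k.2, hk⟩, d, hd, h⟩⟩

section Stabilizer

variable {k : E6}

theorem inv_smul_one (hk : k • one = one) : k⁻¹ • one = one := inv_smul_eq_iff.mpr hk.symm

theorem det_smul_one_sub_E6_smul (hk : k • one = one) (t : ℝ) (M : J) :
    det (t • one - k • M) = det (t • one - M) := by
  rw [← det_E6_smul k (t • one - M), smul_sub, smul_comm, hk]

theorem trace_E6_smul (hk : k • one = one) (M : J) : trace (k • M) = trace M :=
  (trace_quad_eq_of_det_smul_one_sub_eq (det_smul_one_sub_E6_smul hk · M)).1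

theorem quad_E6_smul (hk : k • one = one) (M : J) : quad (k • M) = quad M :=
  (trace_quad_eq_of_det_smul_one_sub_eq (det_smul_one_sub_E6_smul hk · M)).2

theorem trace_jmul_E6_smul (hk : k • one = one) (M N : J) :
    trace (jmul (k • M) (k • N)) = trace (jmul M N) := by
  simp only [trace_jmul, ← smul_add, trace_E6_smul hk, quad_E6_smul hk]

theorem E6_smul_jmul_self (hk : k • one = one) (M : J) :
    k • jmul M M = jmul (k • M) (k • M) := by
  refine eq_of_trace_jmul_eq fun P => ?_
  obtain ⟨N, rfl⟩ := MulAction.surjective k P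
  rw [trace_jmul_E6_smul hk, trace_jmul_jmul, trace_jmul_jmul, trace_jmul_E6_smul hk,
    smul_comm (-1 : ℝ) k N]
  simp only [← smul_add, det_E6_smul, trace_E6_smul hk, quad_E6_smul hk]

theorem E6_smul_jmul (hk : k • one = one) (M N : J) : k • jmul M N = jmul (k • M) (k • N) := by
  rw [jmul_eq_polarization, jmul_eq_polarization (k • M), ← smul_comm, smul_sub k, smul_sub k,
    E6_smul_jmul_self hk, E6_smul_jmul_self hk, E6_smul_jmul_self hk, smul_add]

end Stabilizer

/-! ### Some elements of `E₆₍₋₂₆₎` -/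

theorem det_eq_of_ne (M : J) {i j k : Fin 3} (hij : i ≠ j) (hjk : j ≠ k) (hki : k ≠ i) :
    det M = diagEntry M i * diagEntry M j * diagEntry M k
      - (diagEntry M i * (M.1 j k).normSq + diagEntry M j * (M.1 k i).normSq
        + diagEntry M k * (M.1 i j).normSq)
      + 2 * (M.1 j k * M.1 k i * M.1 i j).re := by
  have h₁ := re_mul_rotate (offEntry M 0) (offEntry M 1) (offEntry M 2)
  have h₂ := re_mul_rotate (offEntry M 2) (offEntry M 0) (offEntry M 1)
  rw [det_eq, coe_eq_of_entries M]
  fin_cases i <;> fin_cases j <;> fin_cases k <;>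
    simp_all [re_star_mul_star_mul_star] <;> ring

/-- The simultaneous permutation of rows and columns. -/
def perm (σ : Equiv.Perm (Fin 3)) : E6 :=
  toE6
    { toFun M := ⟨M.1.submatrix σ σ, by
        ext1 i j
        exact star_apply M (σ i) (σ j)⟩
      map_add' _ _ := rfl
      map_smul' _ _ := rfl }
    fun M => by
      rw [det_eq_of_ne M (σ.injective.ne zero_ne_one) (σ.injective.ne (by decide : (1 : Fin 3) ≠ 2))
        (σ.injective.ne (by decide : (2 : Fin 3) ≠ 0))]
      rfl

@[simp] theorem perm_smul_apply (σ : Equiv.Perm (Fin 3)) (M : J) (i j : Fin 3) :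
    (perm σ • M).1 i j = M.1 (σ i) (σ j) := rfl

theorem perm_smul_diag (σ : Equiv.Perm (Fin 3)) (d : Fin 3 → ℝ) :
    perm σ • diag d = diag (d ∘ σ) :=
  Subtype.ext (Matrix.submatrix_diagonal_equiv _ σ)

theorem offEntry_perm_addRight_smul (c : Fin 3) (M : J) (i : Fin 3) :
    offEntry (perm (Equiv.addRight c) • M) i = offEntry M (i + c) := by
  simp only [offEntry, perm_smul_apply, Equiv.coe_addRight, add_right_comm]

/-- The action of the elementary matrix with entry `a` in position `(0, 1)`. -/
def transvec (a : Octonion) : E6 :=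
  toE6
    { toFun M := ofEntries
        ![diagEntry M 0 + 2 * innerForm a (offEntry M 2) + a.normSq * diagEntry M 1,
          diagEntry M 1, diagEntry M 2]
        ![offEntry M 0, offEntry M 1 + star (a * offEntry M 0), offEntry M 2 + diagEntry M 1 • a]
      map_add' M N := J_ext (fun i => by fin_cases i <;> simp; ring) fun i => by
        fin_cases i <;> simp [mul_add, add_smul] <;> abel
      map_smul' r M := J_ext (fun i => by fin_cases i <;> simp; ring) fun i => by
        fin_cases i <;> simp [mul_smul_comm, mul_smul] }
    fun M => by
      have h (z : Octonion) : (offEntry M 0 * star (a * offEntry M 0) * z).re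
          = (offEntry M 0).normSq * innerForm a z := by
        rw [star_mul, mul_star_mul_cancel, smul_mul_assoc, re_smul, innerForm_apply]
      have h' : innerForm (offEntry M 1) (star (a * offEntry M 0))
          = (offEntry M 0 * offEntry M 1 * a).re := by
        rw [innerForm_star_right, re_mul_rotate, re_mul_assoc]
      simp only [det_eq, LinearMap.coe_mk, AddHom.coe_mk, diagEntry_ofEntries, offEntry_ofEntries,
        Matrix.cons_val, normSq_add, normSq_smul, normSq_star, normSq_mul, mul_add, add_mul,
        mul_smul_comm, map_smul, innerForm_self, innerForm_comm _ a, smul_eq_mul, re_add, re_smul,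
        h, h']
      ring

theorem diagEntry_transvec_smul (a : Octonion) (M : J) : diagEntry (transvec a • M) =
    ![diagEntry M 0 + 2 * innerForm a (offEntry M 2) + a.normSq * diagEntry M 1,
      diagEntry M 1, diagEntry M 2] :=
  funext fun _ => diagEntry_ofEntries _ _ _

theorem offEntry_transvec_smul (a : Octonion) (M : J) : offEntry (transvec a • M) =
    ![offEntry M 0, offEntry M 1 + star (a * offEntry M 0), offEntry M 2 + diagEntry M 1 • a] :=
  funext fun _ => offEntry_ofEntries _ _ _

/-- The transformation of the off-diagonal entries by the three multiplications by a unit octonion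
that are related by triality. -/
def spin (u : Octonion) (hu : u.normSq = 1) : E6 :=
  toE6
    { toFun M := ofEntries (diagEntry M)
        ![u * offEntry M 0, offEntry M 1 * u, (star u * offEntry M 2) * star u]
      map_add' M N := J_ext (fun i => by simp) fun i => by
        fin_cases i <;> simp [mul_add, add_mul]
      map_smul' r M := J_ext (fun i => by simp) fun i => by
        fin_cases i <;> simp [mul_smul_comm, smul_mul_assoc] }
    fun M => by
      simp [det_eq, re_mul_mul_triality, normSq_mul, hu]

@[simp] theorem diagEntry_spin_smul (u : Octonion) (hu : u.normSq = 1) (M : J) :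
    diagEntry (spin u hu • M) = diagEntry M :=
  funext fun _ => diagEntry_ofEntries _ _ _

@[simp] theorem offEntry_spin_smul (u : Octonion) (hu : u.normSq = 1) (M : J) :
    offEntry (spin u hu • M) =
      ![u * offEntry M 0, offEntry M 1 * u, (star u * offEntry M 2) * star u] :=
  funext fun _ => offEntry_ofEntries _ _ _

/-! ### Reduction to complex matrices -/

theorem spin_mem_fixingSubgroup (u : Octonion) (hu : u.normSq = 1) :
    spin u hu ∈ fixingSubgroup E6 (Set.range diag) := by
  rw [mem_fixingSubgroup_iff]
  rintro _ ⟨d, rfl⟩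
  exact J_ext (fun i => by simp) fun i => by fin_cases i <;> simp

theorem exists_normSq_eq_one_mul_eq_ofReal (x : Octonion) :
    ∃ u : Octonion, u.normSq = 1 ∧ ∃ r : ℝ, u * x = ofReal r := by
  rcases eq_or_ne x 0 with rfl | hx
  · exact ⟨ofReal 1, by simp [normSq], 0, by ext k <;> simp⟩
  · have hpos : 0 < x.normSq := x.normSq_nonneg.lt_of_ne' (normSq_eq_zero.not.mpr hx)
    refine ⟨(√x.normSq)⁻¹ • star x, ?_, (√x.normSq)⁻¹ * x.normSq, ?_⟩
    · rw [normSq_smul, normSq_star, inv_pow, Real.sq_sqrt hpos.le, inv_mul_cancel₀ hpos.ne']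
    · rw [smul_mul_assoc, ← smul_ofReal, ← normSq_star x, ← mul_star_self, star_star]

theorem exists_spin_conj (u : Octonion) (hu : u.normSq = 1) :
    ∃ g ∈ fixingSubgroup E6 (Set.range diag), ∀ M,
      offEntry (g • M) 0 = (u * offEntry M 0) * star u ∧
      offEntry (g • M) 1 = (u * (offEntry M 1 * u)) * u := by
  have hu' : (star u).normSq = 1 := by rw [normSq_star, hu]
  let k := perm (Equiv.addRight 1) * spin (star u) hu' * perm (Equiv.addRight 2)
  have hk : k ∈ fixingSubgroup E6 (Set.range diag) := by
    rw [mem_fixingSubgroup_iff]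
    rintro _ ⟨d, rfl⟩
    simp only [k, mul_smul, perm_smul_diag,
      (mem_fixingSubgroup_iff E6).mp (spin_mem_fixingSubgroup _ hu') _ ⟨_, rfl⟩]
    congr 1
    funext i
    simp [add_assoc]
  refine ⟨k * spin u hu, mul_mem hk (spin_mem_fixingSubgroup u hu), fun M => ?_⟩
  simp [k, mul_smul, offEntry_perm_addRight_smul]

theorem exists_unit_pow_three_mul (z : ℂ) :
    ∃ w : ℂ, Complex.normSq w = 1 ∧ ∃ r : ℝ, w ^ 3 * z = r := by
  rcases eq_or_ne z 0 with rfl | hz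
  · exact ⟨1, by simp, 0, by simp⟩
  · obtain ⟨w, hw⟩ := IsAlgClosed.exists_pow_nat_eq (star z / ‖z‖) three_pos
    have hn : ‖w‖ = 1 := by
      refine (pow_eq_one_iff_of_nonneg (norm_nonneg w) three_ne_zero).mp ?_
      rw [← norm_pow, hw, norm_div, norm_star, Complex.norm_real, norm_norm,
        div_self (norm_ne_zero_iff.mpr hz)]
    refine ⟨w, by rw [Complex.normSq_eq_norm_sq, hn, one_pow], Complex.normSq z / ‖z‖, ?_⟩
    rw [hw, Complex.ofReal_div, Complex.normSq_eq_conj_mul_self, Complex.star_def,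
      div_mul_eq_mul_div]

theorem exists_smul_offEntry_eq_ofComplex (M : J) : ∃ g ∈ fixingSubgroup E6 (Set.range diag),
    ∃ e : Octonion, e.IsImaginaryUnit ∧
      ∃ z : Fin 3 → ℂ, ∀ i, offEntry (g • M) i = ofComplex e (z i) := by
  obtain ⟨u, hu, r, hr⟩ := exists_normSq_eq_one_mul_eq_ofReal (offEntry M 0)
  obtain ⟨e, he, z, hz⟩ := exists_eq_ofComplex (offEntry M 1 * u)
  obtain ⟨w, hw, s, hs⟩ := exists_unit_pow_three_mul z
  have hw' : (ofComplex e w).normSq = 1 := by rw [normSq_ofComplex he, hw]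
  obtain ⟨k, hk, hk'⟩ := exists_spin_conj (ofComplex e w) hw'
  set N := k • spin u hu • M
  have h0 : offEntry N 0 = ofReal r := by
    simp only [N, (hk' _).1, offEntry_spin_smul, Matrix.cons_val, hr, mul_ofReal, smul_mul_assoc,
      mul_star_self, hw', smul_ofReal, mul_one]
  have h1 : offEntry N 1 = ofReal s := by
    simp only [N, (hk' _).2, offEntry_spin_smul, Matrix.cons_val, hz, ← ofComplex_mul he]
    rw [← ofComplex_ofReal e, ← hs]
    ring_nf
  obtain ⟨e', he', z', hz'⟩ := exists_eq_ofComplex (offEntry N 2)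
  refine ⟨k * spin u hu, mul_mem hk (spin_mem_fixingSubgroup u hu), e', he', ![r, s, z'],
    fun i => ?_⟩
  rw [mul_smul]
  fin_cases i
  · exact h0.trans (ofComplex_ofReal e' r).symm
  · exact h1.trans (ofComplex_ofReal e' s).symm
  · exact hz'

open Matrix

/-! ### The action of `SL₃(ℂ)` -/

/-- The embedding of the Hermitian complex matrices in the exceptional Jordan algebra defined by
an imaginary unit. It is only meaningful on Hermitian matrices: the entries below the diagonal are
ignored. -/
def ofMatrix (e : Octonion) (A : Matrix (Fin 3) (Fin 3) ℂ) : J :=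
  ofEntries (fun i => (A i i).re) fun i => ofComplex e (A (i + 1) (i + 2))

@[simp] theorem diagEntry_ofMatrix (e : Octonion) (A : Matrix (Fin 3) (Fin 3) ℂ) (i : Fin 3) :
    diagEntry (ofMatrix e A) i = (A i i).re := diagEntry_ofEntries _ _ _

@[simp] theorem offEntry_ofMatrix (e : Octonion) (A : Matrix (Fin 3) (Fin 3) ℂ) (i : Fin 3) :
    offEntry (ofMatrix e A) i = ofComplex e (A (i + 1) (i + 2)) := offEntry_ofEntries _ _ _

theorem ofMatrix_apply {e : Octonion} (he : e.IsImaginaryUnit) {A : Matrix (Fin 3) (Fin 3) ℂ}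
    (hA : A.IsHermitian) (i j : Fin 3) : (ofMatrix e A).1 i j = ofComplex e (A i j) := by
  have hdiag (i : Fin 3) : ofReal (A i i).re = ofComplex e (A i i) := by
    rw [← ofComplex_ofReal e, Complex.conj_eq_iff_re.mp (hA.apply i i)]
  rw [coe_eq_of_entries]
  fin_cases i <;> fin_cases j <;> simp [hdiag, star_ofComplex he, -RCLike.star_def, hA.apply]

theorem ofMatrix_diagonal (e : Octonion) (d : Fin 3 → ℝ) :
    ofMatrix e (diagonal fun i => (d i : ℂ)) = diag d := by
  refine J_ext (fun i => by simp) fun i => ?_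
  simp

theorem perm_smul_ofMatrix {e : Octonion} (he : e.IsImaginaryUnit)
    {A : Matrix (Fin 3) (Fin 3) ℂ} (hA : A.IsHermitian) (σ : Equiv.Perm (Fin 3)) :
    perm σ • ofMatrix e A = ofMatrix e (A.submatrix σ σ) := by
  apply Subtype.ext
  ext1 i j
  rw [perm_smul_apply, ofMatrix_apply he hA, ofMatrix_apply he (hA.submatrix σ), submatrix_apply]

theorem transvec_smul_ofMatrix {e : Octonion} (he : e.IsImaginaryUnit)
    {A : Matrix (Fin 3) (Fin 3) ℂ} (hA : A.IsHermitian) (z : ℂ) :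
    transvec (ofComplex e z) • ofMatrix e A =
      ofMatrix e (transvection 0 1 z * A * (transvection 0 1 z)ᴴ) := by
  have hconj : (transvection (0 : Fin 3) 1 z)ᴴ = transvection 1 0 (star z) := by
    simp [transvection]
  have hreal : ((A 1 1).re : ℂ) = A 1 1 := Complex.conj_eq_iff_re.mp (hA.apply 1 1)
  refine J_ext (fun i => ?_) fun i => ?_
  · rw [diagEntry_transvec_smul, hconj]
    fin_cases i
    · have him : (A 1 1).im = 0 := Complex.conj_eq_iff_im.mp (hA.apply 1 1)
      simp [innerForm_ofComplex he, normSq_ofComplex he, ← hA.apply 1 0, him, Complex.normSq_apply]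
      ring
    all_goals simp
  · rw [offEntry_transvec_smul, hconj]
    fin_cases i
    · simp
    · simp [star_ofComplex he, ← ofComplex_mul he, ← hA.apply 2 1]
    · simpa [hreal, mul_comm] using ((ofComplex e).map_smul (A 1 1).re z).symm

/-- The complex matrix `g` acts on the image of the Hermitian matrices through an element of
`E₆₍₋₂₆₎`. -/
def ActsByE6 (e : Octonion) (g : Matrix (Fin 3) (Fin 3) ℂ) : Prop :=
  ∃ h : E6, ∀ A : Matrix (Fin 3) (Fin 3) ℂ, A.IsHermitian →
    h • ofMatrix e A = ofMatrix e (g * A * gᴴ)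

theorem ActsByE6.mul {e : Octonion} {g g' : Matrix (Fin 3) (Fin 3) ℂ} (hg : ActsByE6 e g)
    (hg' : ActsByE6 e g') : ActsByE6 e (g * g') := by
  obtain ⟨h, hh⟩ := hg
  obtain ⟨h', hh'⟩ := hg'
  refine ⟨h * h', fun A hA => ?_⟩
  rw [mul_smul, hh' A hA, hh _ (isHermitian_mul_mul_conjTranspose g' hA), conjTranspose_mul]
  simp only [Matrix.mul_assoc]

theorem actsByE6_transvection {e : Octonion} (he : e.IsImaginaryUnit) {i j : Fin 3}
    (hij : i ≠ j) (z : ℂ) : ActsByE6 e (transvection i j z) := by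
  obtain ⟨σ, rfl, rfl⟩ : ∃ σ : Equiv.Perm (Fin 3), σ 0 = i ∧ σ 1 = j := by
    revert i j; decide
  refine ⟨(perm σ)⁻¹ * transvec (ofComplex e z) * perm σ, fun A hA => ?_⟩
  have hσ : (transvection (σ 0) (σ 1) z).submatrix σ σ = transvection 0 1 z := by
    ext k l
    simp [transvection, one_apply, single_apply, σ.injective.eq_iff]
  rw [mul_smul, mul_smul, inv_smul_eq_iff, perm_smul_ofMatrix he hA,
    perm_smul_ofMatrix he (isHermitian_mul_mul_conjTranspose _ hA),
    transvec_smul_ofMatrix he (hA.submatrix σ), ← hσ, conjTranspose_submatrix,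
    submatrix_mul_equiv, submatrix_mul_equiv]

section DiagonalFromTransvections

variable {F ι : Type*} [Field F] [Fintype ι] [DecidableEq ι]

-- Whitehead's factorization.
theorem diag2n_eq_mul_transvection {i j : ι} (hij : i ≠ j) {a : F} (ha : a ≠ 0) :
    (SpecialLinearGroup.diag2n hij a ha).1 =
      transvection i j a * transvection j i (-a⁻¹) * transvection i j a *
        (transvection i j (-1) * transvection j i 1 * transvection i j (-1)) := by
  rw [SpecialLinearGroup.diag2n_coe]
  have hdiag : diagonal (fun k => if k = i then a else if k = j then a⁻¹ else 1) =
      1 + single i i a - single i i 1 + single j j a⁻¹ - single j j 1 := by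
    ext k l
    simp only [diagonal_apply, Matrix.add_apply, Matrix.sub_apply, one_apply, single_apply]
    grind
  simp only [hdiag, transvection, mul_add, add_mul, mul_one, one_mul, single_mul_single_same,
    single_mul_single_of_ne, hij, hij.symm, ne_eq, not_false_eq_true, mul_neg, neg_mul,
    mul_inv_cancel₀ ha, inv_mul_cancel₀ ha, ← single_neg, zero_mul, mul_zero]
  abel

theorem specialLinearGroup_transvection_induction [Nontrivial ι] {P : Matrix ι ι F → Prop}
    (htransvection : ∀ i j, i ≠ j → ∀ c, P (transvection i j c))
    (hmul : ∀ A B, P A → P B → P (A * B)) (g : SpecialLinearGroup ι F) : P g.1 := by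
  refine SpecialLinearGroup.diagonal_transvection_induction' (fun g => P g.1) g
    (fun i j hij a ha => ?_) (fun i j hij a => htransvection i j hij a) fun _ _ => hmul _ _
  have hprod (b c d : F) : P (transvection i j b * transvection j i c * transvection i j d) :=
    hmul _ _ (hmul _ _ (htransvection i j hij b) (htransvection j i hij.symm c))
      (htransvection i j hij d)
  rw [diag2n_eq_mul_transvection]
  exact hmul _ _ (hprod _ _ _) (hprod _ _ _)

end DiagonalFromTransvections

theorem actsByE6_of_specialLinearGroup {e : Octonion} (he : e.IsImaginaryUnit)
    (g : SpecialLinearGroup (Fin 3) ℂ) : ActsByE6 e g.1 :=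
  specialLinearGroup_transvection_induction (fun _ _ hij c => actsByE6_transvection he hij c)
    (fun _ _ => ActsByE6.mul) g

theorem exists_specialUnitary_diagonal {n : Type*} [Fintype n] [DecidableEq n] [Nonempty n]
    {A : Matrix n n ℂ} (hA : A.IsHermitian) :
    ∃ (U : SpecialLinearGroup n ℂ) (d : n → ℝ), U.1 * U.1ᴴ = 1 ∧
      A = U.1 * diagonal (fun i => (d i : ℂ)) * U.1ᴴ := by
  let V : Matrix n n ℂ := hA.eigenvectorUnitary
  have hV : V * Vᴴ = 1 := Unitary.mul_star_self_of_mem hA.eigenvectorUnitary.2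
  have hdet : V.det * star V.det = 1 := by rw [← det_conjTranspose, ← det_mul, hV, det_one]
  let i₀ : n := Classical.arbitrary n
  let E : Matrix n n ℂ := diagonal (Function.update 1 i₀ (star V.det))
  have hE (d : n → ℂ) : E * diagonal d * Eᴴ = diagonal d := by
    rw [diagonal_conjTranspose, diagonal_mul_diagonal, diagonal_mul_diagonal]
    congr 1
    funext i
    obtain rfl | hi := eq_or_ne i i₀
    · rw [Pi.star_apply, Function.update_self, star_star]
      linear_combination d i₀ * hdet
    · simp [hi]
  refine ⟨⟨V * E, ?_⟩, hA.eigenvalues, ?_, ?_⟩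
  · rw [det_mul, det_diagonal, Finset.prod_update_of_mem (Finset.mem_univ i₀)]
    simpa using hdet
  · have hE' := hE 1
    rw [Pi.one_def, diagonal_one, Matrix.mul_one] at hE'
    rw [conjTranspose_mul, Matrix.mul_assoc, ← Matrix.mul_assoc E, hE', Matrix.one_mul, hV]
  · calc A = V * diagonal (fun i => (hA.eigenvalues i : ℂ)) * Vᴴ := hA.spectral_theorem
      _ = V * (E * diagonal (fun i => (hA.eigenvalues i : ℂ)) * Eᴴ) * Vᴴ := by rw [hE]
      _ = _ := by simp only [conjTranspose_mul, Matrix.mul_assoc]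

theorem ofMatrix_one (e : Octonion) : ofMatrix e 1 = one := by
  have h := ofMatrix_diagonal e fun _ => 1
  rwa [Complex.ofReal_one, diagonal_one] at h

theorem isHermitian_diagonal_ofReal {n : Type*} [DecidableEq n] (d : n → ℝ) :
    (diagonal fun i => (d i : ℂ)).IsHermitian :=
  isHermitian_diagonal_of_self_adjoint _ (funext fun i => Complex.conj_ofReal (d i))

theorem exists_E6_smul_diag_eq_ofMatrix {e : Octonion} (he : e.IsImaginaryUnit)
    (g : SpecialLinearGroup (Fin 3) ℂ) : ∃ h : E6, h • one = ofMatrix e (g.1 * g.1ᴴ) ∧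
      ∀ d : Fin 3 → ℝ,
        h • diag d = ofMatrix e (g.1 * diagonal (fun i => (d i : ℂ)) * g.1ᴴ) := by
  obtain ⟨h, hh⟩ := actsByE6_of_specialLinearGroup he g
  refine ⟨h, ?_, fun d => ?_⟩
  · rw [← ofMatrix_one e, hh _ isHermitian_one, Matrix.mul_one]
  · rw [← ofMatrix_diagonal e, hh _ (isHermitian_diagonal_ofReal d)]

theorem exists_smul_eq_ofMatrix (M : J) : ∃ g ∈ fixingSubgroup E6 (Set.range diag),
    ∃ e : Octonion, e.IsImaginaryUnit ∧
      ∃ A : Matrix (Fin 3) (Fin 3) ℂ, A.IsHermitian ∧ g • M = ofMatrix e A := by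
  obtain ⟨g, hg, e, he, z, hz⟩ := exists_smul_offEntry_eq_ofComplex M
  refine ⟨g, hg, e, he, !![(diagEntry (g • M) 0 : ℂ), z 2, star (z 1);
    star (z 2), (diagEntry (g • M) 1 : ℂ), z 0;
    z 1, star (z 0), (diagEntry (g • M) 2 : ℂ)], ?_, J_ext (fun i => ?_) fun i => ?_⟩
  · refine IsHermitian.ext fun i j => ?_
    fin_cases i <;> fin_cases j <;> simp
  · fin_cases i <;> simp
  · fin_cases i <;> simp [hz]

theorem exists_smul_eq_diag (M : J) : ∃ k : E6, k • one = one ∧ ∃ d, k • M = diag d := by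
  obtain ⟨g, hg, e, he, A, hA, hgM⟩ := exists_smul_eq_ofMatrix M
  obtain ⟨U, d, hU, rfl⟩ := exists_specialUnitary_diagonal hA
  obtain ⟨h, hone, hdiag⟩ := exists_E6_smul_diag_eq_ofMatrix he U
  have hgone : g • one = one := (mem_fixingSubgroup_iff E6).mp hg _ ⟨_, rfl⟩
  rw [hU, ofMatrix_one] at hone
  refine ⟨h⁻¹ * g, by rw [mul_smul, hgone, inv_smul_one hone], d, ?_⟩
  rw [mul_smul, hgM, inv_smul_eq_iff, hdiag]

/-! ### Positivity -/

theorem diag_add (c d : Fin 3 → ℝ) : diag (c + d) = diag c + diag d :=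
  J_ext (fun i => by simp) fun i => by simp

theorem diag_sub (c d : Fin 3 → ℝ) : diag (c - d) = diag c - diag d :=
  J_ext (fun i => by simp) fun i => by simp

theorem diag_smul (r : ℝ) (d : Fin 3 → ℝ) : diag (r • d) = r • diag d :=
  J_ext (fun i => by simp) fun i => by simp

theorem det_diag (d : Fin 3 → ℝ) : det (diag d) = ∏ i, d i := by
  simp [det_eq, Fin.prod_univ_three]

theorem det_one : det one = 1 := by simp [one, det_diag]

theorem det_smul_one_sub_diag (t : ℝ) (d : Fin 3 → ℝ) :
    det (t • one - diag d) = ∏ i, (t - d i) := by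
  rw [one, ← diag_smul, ← diag_sub, det_diag]
  simp only [Pi.sub_apply, Pi.smul_apply, smul_eq_mul, mul_one]

theorem trace_jmul_jmul_diag (w : J) (a : Fin 3 → ℝ) : trace (jmul w (jmul w (diag a))) =
    ∑ i, (a i * diagEntry w i ^ 2 + (a (i + 1) + a (i + 2)) * (offEntry w i).normSq) := by
  simp [trace, diagEntry_jmul, offEntry_jmul, innerForm_self, Fin.sum_univ_three]
  ring

theorem two_mul_quad_le (M : J) : 2 * quad M ≤ trace M ^ 2 := by
  have h := fun i => (offEntry M i).normSq_nonneg
  simp only [quad, trace, Fin.sum_univ_three, Fin.isValue, Fin.reduceAdd, zero_add]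
  nlinarith [h 0, h 1, h 2, sq_nonneg (diagEntry M 0), sq_nonneg (diagEntry M 1),
    sq_nonneg (diagEntry M 2)]

-- For the matrix `Q` with `1` in the two entries opposite to the diagonal entry `i`, the
-- characteristic polynomial of `g⁻¹ Q` is `t ^ 3 - p i * t`.
theorem pos_of_E6_smul_one_eq_diag {g : E6} {p : Fin 3 → ℝ} (hg : g • one = diag p)
    (i : Fin 3) : 0 < p i := by
  have hprod : ∏ i, p i = 1 := by rw [← det_diag, ← hg, det_E6_smul, det_one]
  have hne : p i ≠ 0 := Finset.prod_ne_zero_iff.mp (hprod.trans_ne one_ne_zero) i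
    (Finset.mem_univ i)
  have hnorm : (ofReal 1).normSq = 1 := by simp [normSq]
  set Q : J := ofEntries 0 (Pi.single i (ofReal 1)) with hQ
  have hchar (t : ℝ) : det (t • one - g⁻¹ • Q) = t ^ 3 - p i * t := by
    rw [← det_E6_smul g, smul_sub, smul_inv_smul, smul_comm, hg]
    rw [Fin.prod_univ_three] at hprod
    simp only [det_eq, diagEntry_sub, diagEntry_smul, diagEntry_diag, hQ, diagEntry_ofEntries,
      Pi.zero_apply]
    fin_cases i <;> simp [hnorm] <;> linear_combination t ^ 3 * hprod
  simp only [det_smul_one_sub] at hchar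
  have htrace : trace (g⁻¹ • Q) = 0 := by linarith [hchar 0, hchar 1, hchar (-1)]
  have hquad : quad (g⁻¹ • Q) = -p i := by linarith [hchar 0, hchar 1, hchar (-1)]
  have hle := two_mul_quad_le (g⁻¹ • Q)
  rw [htrace, hquad] at hle
  exact lt_of_le_of_ne (by linarith) hne.symm

theorem isPositive_E6_smul_one (g : E6) : IsPositive (g • one) := by
  obtain ⟨k, hk, p, hp⟩ := exists_smul_eq_diag (g • one)
  rw [← mul_smul] at hp
  exact isPositive_iff.mpr ⟨k, hk, p, pos_of_E6_smul_one_eq_diag hp, by rw [← mul_smul, hp]⟩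

theorem isPositive_iff_trace_jmul_jmul_pos {M : J} :
    IsPositive M ↔ ∀ w, w ≠ 0 → 0 < trace (jmul w (jmul w M)) := by
  constructor
  · intro hM w hw
    obtain ⟨k, hk, a, ha, hkM⟩ := isPositive_iff.mp hM
    rw [← trace_E6_smul hk, E6_smul_jmul hk, E6_smul_jmul hk, hkM, trace_jmul_jmul_diag]
    have hdiag (i : Fin 3) : 0 ≤ a i * diagEntry (k • w) i ^ 2 :=
      mul_nonneg (ha i).le (sq_nonneg _)
    have hoff (i : Fin 3) : 0 ≤ (a (i + 1) + a (i + 2)) * (offEntry (k • w) i).normSq :=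
      mul_nonneg (add_pos (ha _) (ha _)).le (normSq_nonneg _)
    refine (Finset.sum_nonneg fun i _ => add_nonneg (hdiag i) (hoff i)).lt_of_ne' fun h => hw ?_
    rw [Finset.sum_eq_zero_iff_of_nonneg fun i _ => add_nonneg (hdiag i) (hoff i)] at h
    have hi := fun i => (add_eq_zero_iff_of_nonneg (hdiag i) (hoff i)).mp (h i (Finset.mem_univ i))
    refine (smul_eq_zero_iff_eq k).mp (J_ext (fun i => ?_) fun i => ?_)
    · exact sq_eq_zero_iff.mp ((mul_eq_zero_iff_left (ha i).ne').mp (hi i).1)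
    · exact normSq_eq_zero.mp
        ((mul_eq_zero_iff_left (add_pos (ha (i + 1)) (ha (i + 2))).ne').mp (hi i).2)
  · intro h
    obtain ⟨k, hk, a, hkM⟩ := exists_smul_eq_diag M
    refine isPositive_iff.mpr ⟨k, hk, a, fun i => ?_, hkM⟩
    have hne : k⁻¹ • diag (Pi.single i 1) ≠ 0 := fun h0 => by
      have := congrArg (diagEntry · i) ((smul_eq_zero_iff_eq k⁻¹).mp h0)
      simp at this
    have hpos := h _ hne
    rw [← trace_E6_smul hk, E6_smul_jmul hk, E6_smul_jmul hk, hkM, smul_inv_smul,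
      trace_jmul_jmul_diag] at hpos
    simpa [Pi.single_apply] using hpos

theorem IsPositive.det_pos {M : J} (hM : IsPositive M) : 0 < det M := by
  obtain ⟨k, -, a, ha, hkM⟩ := isPositive_iff.mp hM
  rw [← det_E6_smul k, hkM, det_diag]
  exact Finset.prod_pos fun i _ => ha i

/-- The squares of the Jordan algebra, which are its elements with nonnegative eigenvalues. -/
def IsJordanSquare (M : J) : Prop := ∃ N, jmul N N = M

theorem isJordanSquare_diag {p : Fin 3 → ℝ} (hp : 0 ≤ p) : IsJordanSquare (diag p) :=
  ⟨diag fun i => √(p i), (jmul_diag_diag _ _).trans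
    (congrArg diag (funext fun i => Real.mul_self_sqrt (hp i)))⟩

theorem IsJordanSquare.smul_of_smul_one_eq {k : E6} (hk : k • one = one) {M : J}
    (hM : IsJordanSquare M) : IsJordanSquare (k • M) := by
  obtain ⟨N, rfl⟩ := hM
  exact ⟨k • N, (E6_smul_jmul hk N N).symm⟩

theorem IsJordanSquare.trace_jmul_jmul_nonneg {M : J} (hM : IsJordanSquare M) (w : J) :
    0 ≤ trace (jmul w (jmul w M)) := by
  obtain ⟨N, rfl⟩ := hM
  obtain ⟨k, hk, d, hkN⟩ := exists_smul_eq_diag N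
  rw [← trace_E6_smul hk, E6_smul_jmul hk, E6_smul_jmul hk, E6_smul_jmul hk N, hkN,
    jmul_diag_diag, trace_jmul_jmul_diag]
  have hd (i : Fin 3) : 0 ≤ (d * d) i := mul_self_nonneg (d i)
  exact Finset.sum_nonneg fun i _ => add_nonneg (mul_nonneg (hd i) (sq_nonneg _))
    (mul_nonneg (add_nonneg (hd _) (hd _)) (normSq_nonneg _))

theorem IsPositive.add {M N : J} (hM : IsPositive M) (hN : IsJordanSquare N) :
    IsPositive (M + N) := by
  rw [isPositive_iff_trace_jmul_jmul_pos] at hM ⊢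
  intro w hw
  rw [jmul_add, jmul_add, trace_add]
  exact add_pos_of_pos_of_nonneg (hM w hw) (hN.trace_jmul_jmul_nonneg w)

theorem IsPositive.real_smul {M : J} (hM : IsPositive M) {t : ℝ} (ht : 0 < t) :
    IsPositive (t • M) := by
  obtain ⟨k, hk, a, ha, hkM⟩ := isPositive_iff.mp hM
  exact isPositive_iff.mpr ⟨k, hk, t • a, fun i => mul_pos ht (ha i), by
    rw [smul_comm, hkM, diag_smul]⟩

-- `det (t + g M) = det (t g⁻¹ 1 + M)` is positive for `t > 0`.
theorem IsJordanSquare.smul {M : J} (hM : IsJordanSquare M) (g : E6) :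
    IsJordanSquare (g • M) := by
  obtain ⟨k, hk, r, hr⟩ := exists_smul_eq_diag (g • M)
  have hr0 : 0 ≤ r := fun i => by
    by_contra! hi
    have hpos := (((isPositive_E6_smul_one (k * g)⁻¹).real_smul (neg_pos.mpr hi)).add hM).det_pos
    rw [← det_E6_smul (k * g), smul_add, smul_comm, smul_inv_smul, mul_smul, hr, one,
      ← diag_smul, ← diag_add, det_diag, Finset.prod_eq_zero (Finset.mem_univ i)] at hpos
    · exact hpos.false
    · simp
  rw [← inv_smul_smul k (g • M), hr]
  exact (isJordanSquare_diag hr0).smul_of_smul_one_eq (inv_smul_one hk)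

theorem IsJordanSquare.diagEntry_nonneg {M : J} (hM : IsJordanSquare M) (i : Fin 3) :
    0 ≤ diagEntry M i := by
  obtain ⟨N, rfl⟩ := hM
  rw [diagEntry_jmul, innerForm_self, innerForm_self]
  exact add_nonneg (add_nonneg (mul_self_nonneg _) (normSq_nonneg _)) (normSq_nonneg _)

theorem IsJordanSquare.offEntry_eq_zero {M : J} (hM : IsJordanSquare M) {i j : Fin 3}
    (hi : diagEntry M i = 0) (hij : j ≠ i) : offEntry M j = 0 := by
  obtain ⟨N, rfl⟩ := hM
  rw [diagEntry_jmul, innerForm_self, innerForm_self] at hi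
  have h0 := mul_self_nonneg (diagEntry N i)
  have h1 := (offEntry N (i + 1)).normSq_nonneg
  have h2 := (offEntry N (i + 2)).normSq_nonneg
  have e1 : offEntry N (i + 1) = 0 := normSq_eq_zero.mp (by linarith)
  have e2 : offEntry N (i + 2) = 0 := normSq_eq_zero.mp (by linarith)
  obtain rfl | rfl : j = i + 1 ∨ j = i + 2 := by grind
  · simp [offEntry_jmul, add_assoc, e1, e2]
  · simp [offEntry_jmul, add_assoc, e1, e2]

/-! ### The symmetric space `X_O` -/

theorem exists_E6_smul_one_eq_diag {d : Fin 3 → ℝ} (hprod : ∏ i, d i = 1) :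
    ∃ h : E6, h • one = diag (d * d) := by
  obtain ⟨e, he⟩ := exists_isImaginaryUnit
  have hdet : (diagonal fun i => (d i : ℂ)).det = 1 := by
    rw [det_diagonal, ← Complex.ofReal_prod, hprod, Complex.ofReal_one]
  obtain ⟨h, hone, -⟩ := exists_E6_smul_diag_eq_ofMatrix he ⟨_, hdet⟩
  refine ⟨h, ?_⟩
  rw [hone, isHermitian_diagonal_ofReal d, diagonal_mul_diagonal, ← ofMatrix_diagonal e]
  simp only [Pi.mul_apply, Complex.ofReal_mul]

theorem exists_E6_smul_one_eq_smul_diag (h : E6) : ∃ k : E6, k • one = one ∧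
    ∃ d : Fin 3 → ℝ, (∀ i, 0 < d i) ∧ ∏ i, d i = 1 ∧ h • one = k • diag (d * d) := by
  obtain ⟨k, hk, p, hp⟩ := exists_smul_eq_diag (h • one)
  have hpos := pos_of_E6_smul_one_eq_diag ((mul_smul k h one).trans hp)
  have hprod : ∏ i, p i = 1 := by rw [← det_diag, ← hp, det_E6_smul, det_E6_smul, det_one]
  refine ⟨k⁻¹, inv_smul_one hk, fun i => √(p i), fun i => Real.sqrt_pos.mpr (hpos i), ?_, ?_⟩
  · rw [← Real.sqrt_prod _ fun i _ => (hpos i).le, hprod, Real.sqrt_one]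
  · rw [eq_inv_smul_iff, hp]
    exact congrArg diag (funext fun i => (Real.mul_self_sqrt (hpos i).le).symm)

theorem exists_XO_jmul_self_eq (h : E6) : ∃ N : XO, jmul N.1 N.1 = h • one := by
  obtain ⟨k, hk, d, hd, hprod, hh⟩ := exists_E6_smul_one_eq_smul_diag h
  refine ⟨⟨k • diag d, by rw [det_E6_smul, det_diag, hprod],
    isPositive_iff.mpr ⟨k⁻¹, inv_smul_one hk, d, hd, inv_smul_smul _ _⟩⟩, ?_⟩
  rw [hh, ← jmul_diag_diag, E6_smul_jmul hk]

theorem XO.exists_E6_smul_one_eq (N : XO) : ∃ h : E6, jmul N.1 N.1 = h • one := by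
  obtain ⟨hdet, hpos⟩ := N.2
  obtain ⟨k, hk, d, -, hkN⟩ := isPositive_iff.mp hpos
  have hprod : ∏ i, d i = 1 := by rw [← det_diag, ← hkN, det_E6_smul, hdet]
  obtain ⟨h, hh⟩ := exists_E6_smul_one_eq_diag hprod
  refine ⟨k⁻¹ * h, ?_⟩
  rw [mul_smul, hh, ← jmul_diag_diag, ← hkN, ← E6_smul_jmul hk, inv_smul_smul]

-- `(M - N) ⋆ (M + N) = 0`, and the trace form of the multiplication by `M + N` is definite.
theorem XO_ext {M N : XO} (h : jmul M.1 M.1 = jmul N.1 N.1) : M = N := by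
  apply Subtype.ext
  by_contra hne
  have hw : M.1 - N.1 ≠ 0 := sub_ne_zero.mpr hne
  have hzero : jmul (M.1 - N.1) (M.1 + N.1) = 0 := by
    have heq : jmul (N.1 + (M.1 - N.1)) (M.1 + N.1) = jmul N.1 (M.1 + N.1) := by
      rw [add_sub_cancel, jmul_add, jmul_add, h, jmul_comm M.1, add_comm]
    rw [add_jmul] at heq
    exact left_eq_add.mp heq.symm
  have hpos := add_pos (isPositive_iff_trace_jmul_jmul_pos.mp M.2.2 _ hw)
    (isPositive_iff_trace_jmul_jmul_pos.mp N.2.2 _ hw)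
  rw [← trace_add, ← jmul_add, ← jmul_add, hzero] at hpos
  simp [trace, diagEntry_jmul] at hpos

theorem exists_relative_position_XO (g : E6) (N : XO) : ∃ k : E6, k • one = one ∧
    ∃ d : Fin 3 → ℝ, (∀ i, 0 < d i) ∧ ∏ i, d i = 1 ∧ jmul N.1 N.1 = g • k • diag (d * d) := by
  obtain ⟨h, hN⟩ := N.exists_E6_smul_one_eq
  obtain ⟨k, hk, d, hd, hprod, hh⟩ := exists_E6_smul_one_eq_smul_diag (g⁻¹ * h)
  refine ⟨k, hk, d, hd, hprod, ?_⟩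
  rw [← hh, mul_smul, smul_inv_smul, hN]

/-! ### The distance of `X_O` -/

theorem le_max3 (d : Fin 3 → ℝ) (i : Fin 3) : d i ≤ max3 d := by
  fin_cases i <;> simp [max3]

theorem max3_le {d : Fin 3 → ℝ} {c : ℝ} (h : ∀ i, d i ≤ c) : max3 d ≤ c :=
  max_le (max_le (h 0) (h 1)) (h 2)

theorem max3_le_max3 {d d' : Fin 3 → ℝ} (h : ∀ i, ∃ j, d i = d' j) : max3 d ≤ max3 d' :=
  max3_le fun i => (h i).elim fun j hj => hj.trans_le (le_max3 d' j)

theorem max3_pos {d : Fin 3 → ℝ} (h : ∀ i, 0 < d i) : 0 < max3 d :=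
  (h 0).trans_le (le_max3 d 0)

/-- The distance, in `X_O` or in `X_C`, between the identity and the diagonal matrix with
entries `d`. -/
def diagDist (d : Fin 3 → ℝ) : ℝ := Real.log (max3 d) + Real.log (max3 d⁻¹)

theorem diagDist_congr {d d' : Fin 3 → ℝ} (h : ∀ i, ∃ j, d i = d' j)
    (h' : ∀ i, ∃ j, d' i = d j) : diagDist d = diagDist d' := by
  have hmax := (max3_le_max3 h).antisymm (max3_le_max3 h')
  have hmax_inv : max3 d⁻¹ = max3 d'⁻¹ :=
    (max3_le_max3 fun i => (h i).imp fun _ => congrArg (·⁻¹)).antisymm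
      (max3_le_max3 fun i => (h' i).imp fun _ => congrArg (·⁻¹))
  rw [diagDist, diagDist, hmax, hmax_inv]

theorem exists_eq_of_E6_smul_diag_eq {g g' : E6} {p p' : Fin 3 → ℝ} (hone : g • one = g' • one)
    (hdiag : g • diag p = g' • diag p') (i : Fin 3) : ∃ j, p i = p' j := by
  have hchar : ∏ j, (p i - p j) = ∏ j, (p i - p' j) := by
    rw [← det_smul_one_sub_diag, ← det_smul_one_sub_diag, ← det_E6_smul g, smul_sub,
      smul_comm g (p i), hone, hdiag, ← smul_comm g' (p i), ← smul_sub, det_E6_smul]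
  rw [Finset.prod_eq_zero (Finset.mem_univ i) (sub_self _)] at hchar
  obtain ⟨j, -, hj⟩ := Finset.prod_eq_zero_iff.mp hchar.symm
  exact ⟨j, sub_eq_zero.mp hj⟩

theorem exists_eq_of_E6_smul_diag_mul_self_eq {g g' : E6} {d d' : Fin 3 → ℝ}
    (hd : ∀ i, 0 < d i) (hd' : ∀ i, 0 < d' i) (hone : g • one = g' • one)
    (hdiag : g • diag (d * d) = g' • diag (d' * d')) (i : Fin 3) : ∃ j, d i = d' j :=
  (exists_eq_of_E6_smul_diag_eq hone hdiag i).imp fun j hj =>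
    (mul_self_inj (hd i).le (hd' j).le).mp hj

theorem distO_eq {g : E6} {d : Fin 3 → ℝ} (hd : ∀ i, 0 < d i) (hprod : ∏ i, d i = 1) {M N : XO}
    (hM : jmul M.1 M.1 = g • one) (hN : jmul N.1 N.1 = g • diag (d * d)) :
    distO M N = diagDist d := by
  refine (congrArg sInf ?_).trans (csInf_singleton (diagDist d))
  refine Set.eq_singleton_iff_unique_mem.mpr ⟨⟨g, d, hd, hprod, ?_, ?_, rfl⟩, ?_⟩
  · rw [IsActO, jmul_one_one]
    exact hM
  · rw [IsActO, jmul_diag_diag]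
    exact hN
  · rintro r ⟨g', d', hd', -, hM', hN', rfl⟩
    rw [IsActO, jmul_one_one] at hM'
    rw [IsActO, jmul_diag_diag] at hN'
    have hone := hM'.symm.trans hM
    have hdiag := hN'.symm.trans hN
    exact diagDist_congr (exists_eq_of_E6_smul_diag_mul_self_eq hd' hd hone hdiag)
      (exists_eq_of_E6_smul_diag_mul_self_eq hd hd' hone.symm hdiag.symm)

/-! ### Additivity of the distance -/

section Monotone

variable {p q : Fin 3 → ℝ}

theorem isJordanSquare_E6_smul_diag_sub (hpq : p ≤ q) (g : E6) :
    IsJordanSquare (g • diag q - g • diag p) := by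
  rw [← smul_sub, ← diag_sub]
  exact (isJordanSquare_diag (sub_nonneg.mpr hpq)).smul g

theorem diagEntry_E6_smul_diag_mono (hpq : p ≤ q) (g : E6) (i : Fin 3) :
    diagEntry (g • diag p) i ≤ diagEntry (g • diag q) i :=
  sub_nonneg.mp ((isJordanSquare_E6_smul_diag_sub hpq g).diagEntry_nonneg i)

theorem offEntry_E6_smul_diag_eq (hpq : p ≤ q) (g : E6) {i j : Fin 3}
    (hi : diagEntry (g • diag p) i = diagEntry (g • diag q) i) (hij : j ≠ i) :
    offEntry (g • diag p) j = offEntry (g • diag q) j :=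
  (sub_eq_zero.mp ((isJordanSquare_E6_smul_diag_sub hpq g).offEntry_eq_zero
    (sub_eq_zero.mpr hi.symm) hij)).symm

end Monotone

section DiagonalBounds

variable {d : Fin 3 → ℝ}

theorem mul_self_le_max3_smul (hd : ∀ i, 0 < d i) : d * d ≤ (max3 d * max3 d) • 1 := fun i => by
  simpa using mul_self_le_mul_self (hd i).le (le_max3 d i)

theorem one_le_max3_inv_smul (hd : ∀ i, 0 < d i) :
    1 ≤ (max3 d⁻¹ * max3 d⁻¹) • (d * d) := fun i => by
  have h := mul_le_mul_of_nonneg_right (le_max3 d⁻¹ i) (hd i).le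
  rw [Pi.inv_apply, inv_mul_cancel₀ (hd i).ne'] at h
  exact (one_le_mul_of_one_le_of_one_le h h).trans_eq (mul_mul_mul_comm _ _ _ _)

theorem diagEntry_E6_smul_diag_le (hd : ∀ i, 0 < d i) (g : E6) (i : Fin 3) :
    diagEntry (g • diag (d * d)) i ≤ max3 d * max3 d * diagEntry (g • one) i := by
  have h := diagEntry_E6_smul_diag_mono (mul_self_le_max3_smul hd) g i
  rwa [diag_smul, smul_comm, diagEntry_smul] at h

theorem diagEntry_E6_smul_one_le (hd : ∀ i, 0 < d i) (g : E6) (i : Fin 3) :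
    diagEntry (g • one) i ≤ max3 d⁻¹ * max3 d⁻¹ * diagEntry (g • diag (d * d)) i := by
  have h := diagEntry_E6_smul_diag_mono (one_le_max3_inv_smul hd) g i
  rwa [diag_smul, smul_comm, diagEntry_smul] at h

variable {k : E6} {i j : Fin 3}

theorem offEntry_eq_zero_of_diagEntry_eq_max3 (hd : ∀ i, 0 < d i) (hk : k • one = one)
    (hi : diagEntry (k • diag (d * d)) i = max3 d * max3 d) (hij : j ≠ i) :
    offEntry (k • diag (d * d)) j = 0 := by
  have hone : k • diag ((max3 d * max3 d) • 1) = (max3 d * max3 d) • one := by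
    rw [diag_smul, smul_comm]
    exact congrArg _ hk
  rw [offEntry_E6_smul_diag_eq (mul_self_le_max3_smul hd) k (by rw [hone, hi]; simp) hij, hone]
  simp

theorem offEntry_eq_zero_of_max3_inv_mul_diagEntry_eq_one (hd : ∀ i, 0 < d i)
    (hk : k • one = one)
    (hi : max3 d⁻¹ * max3 d⁻¹ * diagEntry (k • diag (d * d)) i = 1) (hij : j ≠ i) :
    offEntry (k • diag (d * d)) j = 0 := by
  have hone : k • diag 1 = one := hk
  have hinv : max3 d⁻¹ ≠ 0 := (max3_pos fun i => inv_pos.mpr (hd i)).ne'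
  have h := offEntry_E6_smul_diag_eq (one_le_max3_inv_smul hd) k
    (by rw [hone, diag_smul, smul_comm, diagEntry_smul, hi, diagEntry_one]) hij
  rw [hone, diag_smul, smul_comm, offEntry_smul, offEntry_one] at h
  exact (smul_eq_zero_iff_right (mul_ne_zero hinv hinv)).mp h.symm

end DiagonalBounds

theorem log_mul_self (x : ℝ) : Real.log (x * x) = 2 * Real.log x := by
  rw [← sq, Real.log_pow, Nat.cast_ofNat]

theorem log_mul_self_mul {x y : ℝ} (hx : 0 < x) (hy : 0 < y) :
    Real.log (x * x * y) = 2 * Real.log x + Real.log y := by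
  rw [Real.log_mul (mul_pos hx hx).ne' hy.ne', log_mul_self]

theorem exists_diagDist_eq_log_sub_log {d : Fin 3 → ℝ} (hd : ∀ i, 0 < d i) :
    ∃ i j, i ≠ j ∧ diagDist d = Real.log (d i) - Real.log (d j) := by
  obtain ⟨i, hi⟩ := Finite.exists_max d
  obtain ⟨j, hj⟩ := Finite.exists_min d
  have hmax : max3 d = d i := le_antisymm (max3_le hi) (le_max3 d i)
  have hmax_inv : max3 d⁻¹ = (d j)⁻¹ :=
    le_antisymm (max3_le fun l => inv_anti₀ (hd j) (hj l)) (le_max3 d⁻¹ j)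
  have hdist : diagDist d = Real.log (d i) - Real.log (d j) := by
    rw [diagDist, hmax, hmax_inv, Real.log_inv, sub_eq_add_neg]
  obtain rfl | hij := eq_or_ne i j
  · have hconst : d (i + 1) = d i := (hi _).antisymm (hj _)
    exact ⟨i, i + 1, by simp, by rw [hdist, hconst]⟩
  · exact ⟨i, j, hij, hdist⟩

theorem offEntry_eq_zero_of_diagDist_eq_add {k q : E6} (hk : k • one = one) {d w v : Fin 3 → ℝ}
    (hd : ∀ i, 0 < d i) (hw : ∀ i, 0 < w i) (hv : ∀ i, 0 < v i)
    (hone : q • one = k • diag (w * w)) (hdiag : q • diag (v * v) = diag (d * d))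
    (hadd : diagDist d = diagDist w + diagDist v) (l : Fin 3) :
    offEntry (k • diag (w * w)) l = 0 := by
  have hinv {u : Fin 3 → ℝ} (hu : ∀ i, 0 < u i) : 0 < max3 u⁻¹ :=
    max3_pos fun i => inv_pos.mpr (hu i)
  have hw₁ := diagEntry_E6_smul_diag_le hw k
  have hw₂ := diagEntry_E6_smul_one_le hw k
  have hv₁ := diagEntry_E6_smul_diag_le hv q
  have hv₂ := diagEntry_E6_smul_one_le hv q
  simp only [hone, hdiag, hk, diagEntry_one, diagEntry_diag, Pi.mul_apply, mul_one]
    at hw₁ hw₂ hv₁ hv₂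
  set W := k • diag (w * w)
  have hWpos (i : Fin 3) : 0 < diagEntry W i :=
    pos_of_mul_pos_right (zero_lt_one.trans_le (hw₂ i)) (mul_self_nonneg _)
  obtain ⟨i, j, hij, hdist⟩ := exists_diagDist_eq_log_sub_log hd
  have hdi := Real.log_le_log (mul_pos (hd i) (hd i)) (hv₁ i)
  have hdj := Real.log_le_log (hWpos j) (hv₂ j)
  have hwi := Real.log_le_log (hWpos i) (hw₁ i)
  have hwj := Real.log_le_log one_pos (hw₂ j)
  rw [log_mul_self, log_mul_self_mul (max3_pos hv) (hWpos i)] at hdi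
  rw [log_mul_self_mul (hinv hv) (mul_pos (hd j) (hd j)), log_mul_self] at hdj
  rw [log_mul_self] at hwi
  rw [Real.log_one, log_mul_self_mul (hinv hw) (hWpos j)] at hwj
  rw [hdist, diagDist, diagDist] at hadd
  obtain hl | hl : l ≠ i ∨ l ≠ j := by grind
  · have hwpos := max3_pos hw
    refine offEntry_eq_zero_of_diagEntry_eq_max3 hw hk ((hw₁ i).antisymm ?_) hl
    rw [← Real.log_le_log_iff (mul_pos hwpos hwpos) (hWpos i), log_mul_self]
    linarith
  · refine offEntry_eq_zero_of_max3_inv_mul_diagEntry_eq_one hw hk (le_antisymm ?_ (hw₂ j)) hl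
    rw [← Real.log_le_log_iff (zero_lt_one.trans_le (hw₂ j)) one_pos, Real.log_one,
      log_mul_self_mul (hinv hw) (hWpos j)]
    linarith

open scoped ComplexOrder

/-! ### The symmetric space `X_C` -/

theorem mul_diagonal_mul_self_mul_conjTranspose {n : Type*} [Fintype n] [DecidableEq n]
    (g : Matrix n n ℂ) (d : n → ℝ) : g * diagonal (fun i => ((d * d) i : ℂ)) * gᴴ =
      (g * diagonal fun i => (d i : ℂ)) * (g * diagonal fun i => (d i : ℂ))ᴴ := by
  rw [conjTranspose_mul, isHermitian_diagonal_ofReal d, ← Matrix.mul_assoc,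
    Matrix.mul_assoc g (diagonal _) (diagonal _), diagonal_mul_diagonal]
  simp only [Pi.mul_apply, Complex.ofReal_mul]

section SquareRoot

variable {e : Octonion} {B : Matrix (Fin 3) (Fin 3) ℂ}

theorem exists_specialUnitary_diagonal_mul_self (he : e.IsImaginaryUnit) (hB : B.IsHermitian)
    {h : E6} (hBh : ofMatrix e B = h • one) :
    ∃ (U : SpecialLinearGroup (Fin 3) ℂ) (d : Fin 3 → ℝ), U.1 * U.1ᴴ = 1 ∧ (∀ i, 0 < d i) ∧
      ∏ i, d i = 1 ∧ B = U.1 * diagonal (fun i => ((d * d) i : ℂ)) * U.1ᴴ := by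
  obtain ⟨U, p, hU, rfl⟩ := exists_specialUnitary_diagonal hB
  obtain ⟨k, -, hkdiag⟩ := exists_E6_smul_diag_eq_ofMatrix he U
  have hp : (k⁻¹ * h) • one = diag p := by rw [mul_smul, ← hBh, ← hkdiag, inv_smul_smul]
  have hpos := pos_of_E6_smul_one_eq_diag hp
  have hprod : ∏ i, p i = 1 := by rw [← det_diag, ← hp, det_E6_smul, det_one]
  refine ⟨U, fun i => √(p i), hU, fun i => Real.sqrt_pos.mpr (hpos i), ?_, ?_⟩
  · rw [← Real.sqrt_prod _ fun i _ => (hpos i).le, hprod, Real.sqrt_one]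
  · simp only [Pi.mul_apply, Real.mul_self_sqrt (hpos _).le]

theorem exists_XC_mul_self (he : e.IsImaginaryUnit) (hB : B.IsHermitian) {h : E6}
    (hBh : ofMatrix e B = h • one) : ∃ A : XC, A.1 * A.1 = B := by
  obtain ⟨U, d, hU, hd, hprod, rfl⟩ := exists_specialUnitary_diagonal_mul_self he hB hBh
  have hpos : (U.1 * diagonal (fun i => (d i : ℂ)) * U.1ᴴ).PosDef :=
    (PosDef.diagonal fun i => by exact_mod_cast hd i).mul_mul_conjTranspose_same
      (vecMul_injective_of_isUnit (IsUnit.of_mul_eq_one _ hU))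
  refine ⟨⟨_, hpos, ?_⟩, ?_⟩
  · rw [det_mul, det_mul, mul_right_comm, ← det_mul, hU, Matrix.det_one, one_mul, det_diagonal,
      ← Complex.ofReal_prod, hprod, Complex.ofReal_one]
  · rw [mul_diagonal_mul_self_mul_conjTranspose, conjTranspose_mul, isHermitian_diagonal_ofReal d]
    simp only [Matrix.mul_assoc]
    rw [← Matrix.mul_assoc U.1ᴴ, mul_eq_one_comm.mp hU, Matrix.one_mul]

end SquareRoot

theorem XC.isHermitian (A : XC) : A.1ᴴ = A.1 := A.2.1.1

theorem XC.isUnit_det (A : XC) : IsUnit A.1.det := by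
  rw [A.2.2]
  exact isUnit_one

theorem XC.inv_mul (A : XC) : A.1⁻¹ * A.1 = 1 := nonsing_inv_mul _ A.isUnit_det

theorem XC.mul_inv (A : XC) : A.1 * A.1⁻¹ = 1 := mul_nonsing_inv _ A.isUnit_det

theorem XC.inv_conjTranspose (A : XC) : A.1⁻¹ᴴ = A.1⁻¹ := by
  rw [conjTranspose_nonsing_inv, A.isHermitian]

theorem exists_relative_position_XC (A B : XC) :
    ∃ (g : SpecialLinearGroup (Fin 3) ℂ) (d : Fin 3 → ℝ), (∀ i, 0 < d i) ∧ ∏ i, d i = 1 ∧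
      A.1 * A.1 = g.1 * g.1ᴴ ∧
      B.1 * B.1 = g.1 * diagonal (fun i => ((d * d) i : ℂ)) * g.1ᴴ := by
  obtain ⟨e, he⟩ := exists_isImaginaryUnit
  have hdet : (A.1⁻¹ * B.1).det = 1 := by
    rw [det_mul, det_nonsing_inv, A.2.2, B.2.2, Ring.inverse_one, one_mul]
  obtain ⟨h, hone, -⟩ := exists_E6_smul_diag_eq_ofMatrix he ⟨A.1⁻¹ * B.1, hdet⟩
  obtain ⟨U, d, hU, hd, hprod, hUd⟩ := exists_specialUnitary_diagonal_mul_self he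
    (isHermitian_mul_conjTranspose_self _) hone.symm
  refine ⟨⟨A.1 * U.1, by rw [det_mul, A.2.2, U.2, one_mul]⟩, d, hd, hprod, ?_, ?_⟩
  · rw [conjTranspose_mul, A.isHermitian, Matrix.mul_assoc, ← Matrix.mul_assoc U.1, hU,
      Matrix.one_mul]
  · calc B.1 * B.1 = A.1 * (A.1⁻¹ * B.1 * (A.1⁻¹ * B.1)ᴴ) * A.1 := by
          rw [conjTranspose_mul, B.isHermitian, A.inv_conjTranspose]
          simp only [← Matrix.mul_assoc, A.mul_inv, Matrix.one_mul]
          rw [Matrix.mul_assoc, A.inv_mul, Matrix.mul_one]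
      _ = A.1 * (U.1 * diagonal (fun i => ((d * d) i : ℂ)) * U.1ᴴ) * A.1 := by rw [hUd]
      _ = _ := by
          rw [conjTranspose_mul, A.isHermitian]
          simp only [Matrix.mul_assoc]

section OpNorm

open scoped Matrix.Norms.L2Operator

theorem XC.inv_mul_mem_unitary {A : XC} {g : Matrix (Fin 3) (Fin 3) ℂ}
    (hA : A.1 * A.1 = g * gᴴ) : A.1⁻¹ * g ∈ unitary (Matrix (Fin 3) (Fin 3) ℂ) := by
  have h : A.1⁻¹ * g * (A.1⁻¹ * g)ᴴ = 1 := by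
    rw [conjTranspose_mul, A.inv_conjTranspose, Matrix.mul_assoc, ← Matrix.mul_assoc g, ← hA,
      Matrix.mul_assoc, A.mul_inv, Matrix.mul_one, A.inv_mul]
  exact ⟨mul_eq_one_comm.mp h, h⟩

-- `A⁻¹ g` and `B⁻¹ (g D)` are unitary, and `A⁻¹ B = (A⁻¹ g) D (B⁻¹ (g D))*`.
theorem opNorm_inv_mul {A B : XC} {g D : Matrix (Fin 3) (Fin 3) ℂ} (hA : A.1 * A.1 = g * gᴴ)
    (hB : B.1 * B.1 = g * D * (g * D)ᴴ) : opNorm (A.1⁻¹ * B.1) = opNorm D := by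
  have hAB : A.1⁻¹ * B.1 = A.1⁻¹ * g * D * star (B.1⁻¹ * (g * D)) := by
    rw [star_eq_conjTranspose, conjTranspose_mul, B.inv_conjTranspose, ← Matrix.mul_assoc,
      Matrix.mul_assoc A.1⁻¹, Matrix.mul_assoc A.1⁻¹, ← hB, Matrix.mul_assoc, Matrix.mul_assoc,
      B.mul_inv, Matrix.mul_one]
  calc opNorm (A.1⁻¹ * B.1) = ‖A.1⁻¹ * g * D * star (B.1⁻¹ * (g * D))‖ := by
        rw [← hAB, opNorm, l2_opNorm_toEuclideanCLM]
    _ = ‖D‖ := by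
        rw [CStarRing.norm_mul_mem_unitary _ (Unitary.star_mem (XC.inv_mul_mem_unitary hB)),
          CStarRing.norm_mem_unitary_mul _ (XC.inv_mul_mem_unitary hA)]

theorem opNorm_diagonal {d : Fin 3 → ℝ} (hd : ∀ i, 0 < d i) :
    opNorm (diagonal fun i => (d i : ℂ)) = max3 d := by
  have hnorm (i : Fin 3) : ‖(d i : ℂ)‖ = d i := by
    rw [Complex.norm_real, Real.norm_of_nonneg (hd i).le]
  rw [opNorm, l2_opNorm_toEuclideanCLM, l2_opNorm_diagonal]
  refine le_antisymm ((pi_norm_le_iff_of_nonneg (max3_pos hd).le).mpr fun i => ?_)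
    (max3_le fun i => ?_)
  · exact (hnorm i).trans_le (le_max3 d i)
  · exact (hnorm i).ge.trans (norm_le_pi_norm (fun i => (d i : ℂ)) i)

end OpNorm

theorem distC_eq {A B : XC} {g : Matrix (Fin 3) (Fin 3) ℂ} {d : Fin 3 → ℝ}
    (hd : ∀ i, 0 < d i) (hA : A.1 * A.1 = g * gᴴ)
    (hB : B.1 * B.1 = g * diagonal (fun i => ((d * d) i : ℂ)) * gᴴ) :
    distC A B = diagDist d := by
  rw [mul_diagonal_mul_self_mul_conjTranspose] at hB
  have hg : (g * diagonal fun i => (d i : ℂ)) * diagonal (fun i => (d⁻¹ i : ℂ)) = g := by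
    have hinv (i : Fin 3) : (d i : ℂ) * (d⁻¹ i : ℂ) = 1 := by
      exact_mod_cast mul_inv_cancel₀ (hd i).ne'
    simp only [Matrix.mul_assoc, diagonal_mul_diagonal, hinv, diagonal_one, Matrix.mul_one]
  have hA' := hA
  rw [← hg] at hA'
  rw [distC, opNorm_inv_mul hA hB, opNorm_inv_mul hB hA', opNorm_diagonal hd,
    opNorm_diagonal (d := d⁻¹) fun i => inv_pos.mpr (hd i), diagDist]

/-! ### Totally geodesic embeddings -/

theorem exists_XO_jmul_self_eq_smul_ofMatrix {e : Octonion} (he : e.IsImaginaryUnit) (g₀ : E6)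
    (A : XC) :
    ∃ N : XO, jmul N.1 N.1 = g₀ • ofMatrix e (A.1 * A.1) := by
  obtain ⟨h, hone, -⟩ := exists_E6_smul_diag_eq_ofMatrix he ⟨A.1, A.2.2⟩
  obtain ⟨N, hN⟩ := exists_XO_jmul_self_eq (g₀ * h)
  exact ⟨N, by rw [hN, mul_smul, hone, A.isHermitian]⟩

section Embedding

variable {e : Octonion} (he : e.IsImaginaryUnit) (g₀ : E6)

/-- The map `A ↦ √(g₀(A²))` from `X_C` to `X_O`, where complex Hermitian matrices are seen as
elements of `J` by sending the imaginary unit `i` to `e`. -/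
def complexEmbedding (A : XC) : XO := (exists_XO_jmul_self_eq_smul_ofMatrix he g₀ A).choose

theorem jmul_complexEmbedding (A : XC) :
    jmul (complexEmbedding he g₀ A).1 (complexEmbedding he g₀ A).1 =
      g₀ • ofMatrix e (A.1 * A.1) :=
  (exists_XO_jmul_self_eq_smul_ofMatrix he g₀ A).choose_spec

variable {g₀}

theorem mem_range_complexEmbedding {B : Matrix (Fin 3) (Fin 3) ℂ} (hB : B.IsHermitian) {x : XO}
    (hx : jmul x.1 x.1 = g₀ • ofMatrix e B) : x ∈ Set.range (complexEmbedding he g₀) := by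
  obtain ⟨h, hh⟩ := x.exists_E6_smul_one_eq
  obtain ⟨A, hA⟩ := exists_XC_mul_self (h := g₀⁻¹ * h) he hB (by
    rw [mul_smul, ← hh, hx, inv_smul_smul])
  exact ⟨A, XO_ext (by rw [jmul_complexEmbedding, hA, hx])⟩

theorem exists_relative_position_complexEmbedding (g₀ : E6) (A B : XC) :
    ∃ (g : E6) (d : Fin 3 → ℝ), (∀ i, 0 < d i) ∧ ∏ i, d i = 1 ∧ distC A B = diagDist d ∧
      jmul (complexEmbedding he g₀ A).1 (complexEmbedding he g₀ A).1 = g • one ∧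
      jmul (complexEmbedding he g₀ B).1 (complexEmbedding he g₀ B).1 = g • diag (d * d) ∧
      ∀ x : XO, ∀ p, jmul x.1 x.1 = g • diag p → x ∈ Set.range (complexEmbedding he g₀) := by
  obtain ⟨g, d, hd, hprod, hA, hB⟩ := exists_relative_position_XC A B
  obtain ⟨h, hone, hdiag⟩ := exists_E6_smul_diag_eq_ofMatrix he g
  refine ⟨g₀ * h, d, hd, hprod, distC_eq hd hA hB, ?_, ?_, fun x p hx => ?_⟩
  · rw [jmul_complexEmbedding, hA, mul_smul, hone]
  · rw [jmul_complexEmbedding, hB, mul_smul, hdiag]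
  · rw [mul_smul, hdiag] at hx
    exact mem_range_complexEmbedding he
      (isHermitian_mul_mul_conjTranspose g.1 (isHermitian_diagonal_ofReal p)) hx

end Embedding

theorem exists_jmul_self_eq_smul_diag_of_distO_eq_add {M N P : XO} {g : E6} {d : Fin 3 → ℝ}
    (hd : ∀ i, 0 < d i) (hprod : ∏ i, d i = 1) (hM : jmul M.1 M.1 = g • one)
    (hN : jmul N.1 N.1 = g • diag (d * d)) (hadd : distO M N = distO M P + distO P N) :
    ∃ p, jmul P.1 P.1 = g • diag p := by
  obtain ⟨k, hk, w, hw, hwprod, hP⟩ := exists_relative_position_XO g P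
  obtain ⟨h, hh⟩ := P.exists_E6_smul_one_eq
  obtain ⟨l, hl, v, hv, hvprod, hNP⟩ := exists_relative_position_XO h N
  have hMk : jmul M.1 M.1 = (g * k) • one := by rw [hM, mul_smul, hk]
  have hPl : jmul P.1 P.1 = (h * l) • one := by rw [hh, mul_smul, hl]
  rw [← mul_smul] at hNP
  rw [distO_eq hd hprod hM hN, distO_eq hw hwprod hMk (by rw [hP, mul_smul]),
    distO_eq hv hvprod hPl hNP] at hadd
  have hone : (g⁻¹ * (h * l)) • one = k • diag (w * w) := by
    rw [mul_smul, ← hPl, hP, inv_smul_smul]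
  have hdiag : (g⁻¹ * (h * l)) • diag (v * v) = diag (d * d) := by
    rw [mul_smul, ← hNP, hN, inv_smul_smul]
  refine ⟨diagEntry (k • diag (w * w)), hP.trans (congrArg (g • ·) (J_ext (fun i => ?_) ?_))⟩
  · rw [diagEntry_diag]
  · exact fun i => by
      rw [offEntry_eq_zero_of_diagDist_eq_add hk hd hw hv hone hdiag hadd, offEntry_diag]

theorem IsGeodesicSegmentO.distO_eq_add {γ : ℝ → XO} {L : ℝ} {M N : XO}
    (hγ : IsGeodesicSegmentO γ L M N) {t : ℝ} (ht : t ∈ Set.Icc 0 L) :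
    distO M N = distO M (γ t) + distO (γ t) N := by
  obtain ⟨hL, rfl, rfl, hdist⟩ := hγ
  have h₀ : (0 : ℝ) ∈ Set.Icc 0 L := Set.left_mem_Icc.mpr hL
  have h₁ : L ∈ Set.Icc 0 L := Set.right_mem_Icc.mpr hL
  rw [hdist 0 h₀ L h₁, hdist 0 h₀ t ht, hdist t ht L h₁, abs_sub_comm, abs_sub_comm 0 t,
    abs_sub_comm t L, abs_of_nonneg (sub_nonneg.mpr hL), abs_of_nonneg (sub_nonneg.mpr ht.1),
    abs_of_nonneg (sub_nonneg.mpr ht.2)]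
  ring

theorem isTotallyGeodesicEmbedding_complexEmbedding {e : Octonion} (he : e.IsImaginaryUnit)
    (g₀ : E6) : IsTotallyGeodesicEmbedding (complexEmbedding he g₀) where
  isometric A B := by
    obtain ⟨g, d, hd, hprod, hdist, hA, hB, -⟩ :=
      exists_relative_position_complexEmbedding he g₀ A B
    rw [hdist, distO_eq hd hprod hA hB]
  map_geodesicLine γ := by
    rintro ⟨g, a, ha, hγ⟩
    obtain ⟨h, -, hdiag⟩ := exists_E6_smul_diag_eq_ofMatrix he g
    refine ⟨g₀ * h, a, ha, fun t => ?_⟩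
    have ht := hγ t
    rw [IsActC, diagonal_mul_diagonal] at ht
    change jmul _ _ = (g₀ * h) • _
    rw [jmul_diag_diag, mul_smul, hdiag, Function.comp_apply, jmul_complexEmbedding, ht]
    simp only [Pi.mul_apply, Complex.ofReal_mul]
  geodesicSegment_subset A B γ L hγ t ht := by
    obtain ⟨g, d, hd, hprod, -, hA, hB, hmem⟩ :=
      exists_relative_position_complexEmbedding he g₀ A B
    obtain ⟨p, hp⟩ :=
      exists_jmul_self_eq_smul_diag_of_distO_eq_add hd hprod hA hB (hγ.distO_eq_add ht)
    exact hmem _ p hp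

end FreudenthalE6

end

open FreudenthalE6 in
theorem proposition2p9 (x y z : FreudenthalE6.XO) :
    ∃ φ : FreudenthalE6.XC → FreudenthalE6.XO,
      FreudenthalE6.IsTotallyGeodesicEmbedding φ ∧
        x ∈ Set.range φ ∧ y ∈ Set.range φ ∧ z ∈ Set.range φ := by
  obtain ⟨g, hx⟩ := x.exists_E6_smul_one_eq
  obtain ⟨k, hk, d, -, -, hy⟩ := exists_relative_position_XO g y
  obtain ⟨s, hs, e, he, B, hB, hz⟩ := exists_smul_eq_ofMatrix ((g * k)⁻¹ • jmul z.1 z.1)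
  have hdiag (p : Fin 3 → ℝ) : (g * k * s⁻¹) • diag p = g • k • diag p := by
    rw [mul_smul, (mem_fixingSubgroup_iff E6).mp (inv_mem hs) _ ⟨p, rfl⟩, mul_smul]
  refine ⟨complexEmbedding he (g * k * s⁻¹), isTotallyGeodesicEmbedding_complexEmbedding he _,
    mem_range_complexEmbedding he Matrix.isHermitian_one ?_,
    mem_range_complexEmbedding he (isHermitian_diagonal_ofReal (d * d)) ?_,
    mem_range_complexEmbedding he hB ?_⟩
  · rw [ofMatrix_one, hx, one, hdiag]
    exact congrArg (g • ·) hk.symm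
  · rw [ofMatrix_diagonal, hdiag, hy]
  · rw [← hz, mul_smul, inv_smul_smul, smul_inv_smul]
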